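/- **Setting.** Let $\mathbb U_4=\{\pm1,\pm i\}$, let $\mathbb D\subset\mathbb C$ be the open unit disk, let $D(c,r)$ be the closed disk of centre $c$ and radius $r$, let $|(z_1,z_2)|_\infty=\max(|z_1|,|z_2|)$ on $\mathbb C^2$, and write $(x_1,x_2)\prec(y_1,y_2)$ if $|x_2|<|y_2|$, or $|x_2|=|y_2|$ and $|x_1|\le|y_1|$. Let $\Omega_1=\mathrm{SL}(2,\mathbb C)/\mathrm{SL}(2,\mathbb Z[i])$ be the set of unimodular lattices, i.e. of the sets $\Lambda=\mathbb Z[i]u+\mathbb Z[i]v\subset\mathbb C^2$ with $\det(u,v)\in\mathbb U_4$. The diagonal flow $g_t=\mathrm{diag}(e^t,e^{-t})$, $t\in\mathbb R$, acts on $\Omega_1$. A nonzero $u\in\Lambda$ is a minimal vector if for all nonzero $v\in\Lambda$, $|v_1|\le|u_1|$ and $|v_2|\le|u_2|$ imply $|v_1|=|u_1|$ and $|v_2|=|u_2|$. *Transversals.* The open transversal $T$ is the set of $\Lambda\in\Omega_1$ having vectors $u,v$ with $|u_2|,|v_1|<|u_1|=|v_2|=r$ such that all nonzero vectors of $\Lambda$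 of sup norm $\le r$ lie in $\mathbb U_4u\cup\mathbb U_4v$. The full transversal $T'$ is the set of $\Lambda\in\Omega_1$ having minimal vectors $u,v$ with $|u_2|,|v_1|<|u_1|=|v_2|=r$ such that $0$ is the only vector of $\Lambda$ of sup norm $<r$. For $\Lambda\in T$ the first return map is $R(\Lambda)=g_\tau\Lambda$, where $\tau=\min\{s>0: g_s\Lambda\in T'\}$, whenever this minimum exists. Let $\mathcal N$ be the set of $\Lambda\in\Omega_1$ that contain a nonzero vector with a zero coordinate, or two $\mathbb C$-linearly independent vectors $u,v$ with $|u_1|=|v_1|$ or $|u_2|=|v_2|$. *Parametrizations.* For $k\in\{1,2\}$, $\theta\in\mathbb R$ and $(w_1,w_2)\in\mathbb D^2$ put $r=k^{1/4}|1-w_1w_2|^{-1/2}$, $u_1=e^{i\theta}$, $v_2=e^{i((k-1)\pi/4-\theta-\arg(1-w_1w_2))}$, $u=r(u_1,v_2w_2)$, $v=r(u_1w_1,v_2)$, and $$\Psi_1(\theta,w_1,w_2)=\mathbb Z[i]u+\mathbb Z[i]v,\qquad \Psi_2(\theta,w_1,w_2)=\mathbb Z[i]u+\tfrac1{1+i}\mathbb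 Z[i](u+v).$$ *Parameter sets.* Let $\mathcal C=\{w\in\mathbb D:\arg w\in[0,\frac\pi4]\}$, $\mathcal D=\{w\in\mathbb D:|w-1|>1,\ |w-1+i|>1\}$, $\mathcal T=\{w\in\mathbb D:|w-1|>\sqrt2,\ |w+i|>\sqrt2\}$, and $A=D(i,1)$, $A'=D(-i,1)$, $B=D(1+i,1)$, $E=D(\frac{1-i}2,\frac1{\sqrt2})$. Let $W_1^0$ be the set of $(w_1,w_2)\in\mathcal C\times\mathcal D$ satisfying one of: (1) $w_2\in E$ and $w_1\notin A\cup B$; (2) $w_2\in A'\setminus E$ and $w_1\notin A$; (3) $w_2\notin A'\cup B$ and $w_1\ne0$; (4) $w_2\in B$ and $w_1\notin E$. Let $W_2^0=(\mathcal C\setminus D(-i,\sqrt2))\times\mathcal T$. Let $\mathbb D_8$ be the group of isometries of $\mathbb C$ generated by conjugation and the multiplications by elements of $\mathbb U_4$, and let $W_k=\{(\varphi(w_1),\varphi(1)^{-2}\varphi(w_2)):\varphi\in\mathbb D_8,\ (w_1,w_2)\in W_k^0\}$. Let $W'_k$ be the set of $(w_1,w_2)\in W_k$ such that $\Psi_k(\theta,w_1,w_2)\notin\mathcal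 N$ (a condition that does not depend on $\theta$). *The map $T_G$*, on the disjoint union of $W_1'$ and $W_2'$. On $W_1'$, let $a=a_1(w_1,w_2)$ and $g$ be such that $-a(1,w_2)+g(w_1,1)$ is minimal for $\prec$ among all such vectors with $a\in\{1,1+i\}$, $g\in\mathbb Z[i]$ and $|\frac a{w_1}-g|<1$; then $T_G(w_1,w_2)=\left(g-\frac a{w_1},\frac1{g-aw_2}\right)$. On $W_2'$, let $a=a_2(w_1,w_2)=\frac1{1+i}$ and let $g$ be such that $-a(1+w_1,w_2+1)+g(w_1,1)$ is minimal for $\prec$ among all such vectors with $g\in\mathbb Z[i]$ and $|\frac a{w_1}+a-g|<1$; then $T_G(w_1,w_2)=\left(g-\frac a{w_1}-a,\frac1{g-aw_2-a}\right)$. **Theorem.** Let $k\in\{1,2\}$ and $(\theta,w_1,w_2)\in[0,\frac\pi2[\,\times W'_k$. Then $\Psi_k(\theta,w_1,w_2)\in T$ and its first return time $\tau$ to $T'$ exists; the pair $(a,g)$ defining $T_G(w_1,w_2)$ exists and is unique, and $T_G(w_1,w_2)\in\mathbb D^2$; there is exactly one $\alpha\in\mathbb U_4$ for which some $\theta'\in[0,\frac\pi2[$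 satisfies $\theta'\equiv\theta+\arg w_1+\arg\alpha \pmod{2\pi}$; and, with these $\alpha$ and $\theta'$, $$R\circ\Psi_k(\theta,w_1,w_2)=\Psi_j\bigl(\theta',\alpha^2T_G(w_1,w_2)\bigr),$$ where $j=2$ if $a_k(w_1,w_2)=1+i$ and $j=1$ otherwise, and $\alpha^2$ multiplies both coordinates. -/

import Mathlib

noncomputable section

namespace GaussLattice

/-- The complex determinant of the pair of vectors `u`, `v` of `ℂ²`. On `ℂ × ℂ` the norm is the
sup norm `max |z₁| |z₂|`. -/
def det (u v : ℂ × ℂ) : ℂ := u.1 * v.2 - u.2 * v.1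

/-- The `ℤ[i]`-module `ℤ[i] u + ℤ[i] v`. -/
def latticeSpan (u v : ℂ × ℂ) : Set (ℂ × ℂ) :=
  {z | ∃ g h : GaussianInt, z = (g : ℂ) • u + (h : ℂ) • v}

/-- The group `𝕌₄` of fourth roots of unity. -/
def U4 : Set ℂ := {α | α ^ 4 = 1}

/-- The space `Ω₁ = SL(2,ℂ)/SL(2,ℤ[i])` of unimodular Gauss lattices in `ℂ²`: the lattices with
a `ℤ[i]`-basis whose determinant is in `𝕌₄`. -/
def Omega1 : Set (Set (ℂ × ℂ)) :=
  {L | ∃ u v : ℂ × ℂ, det u v ∈ U4 ∧ L = latticeSpan u v}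

/-- The action on lattices of the diagonal flow `g_t = diag (e^t, e^{-t})`. -/
def flow (t : ℝ) (L : Set (ℂ × ℂ)) : Set (ℂ × ℂ) :=
  (fun z : ℂ × ℂ => ((Real.exp t : ℂ) * z.1, (Real.exp (-t) : ℂ) * z.2)) '' L

/-- `u` is a minimal vector of `L`. -/
def IsMinimalVector (L : Set (ℂ × ℂ)) (u : ℂ × ℂ) : Prop :=
  u ∈ L ∧ u ≠ 0 ∧
    ∀ v ∈ L, v ≠ 0 → ‖v.1‖ ≤ ‖u.1‖ → ‖v.2‖ ≤ ‖u.2‖ → ‖v.1‖ = ‖u.1‖ ∧ ‖v.2‖ = ‖u.2‖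

/-- The open transversal `T`. -/
def openTransversal : Set (Set (ℂ × ℂ)) :=
  {L | L ∈ Omega1 ∧ ∃ u ∈ L, ∃ v ∈ L, ∃ r : ℝ,
    ‖u.2‖ < r ∧ ‖v.1‖ < r ∧ ‖u.1‖ = r ∧ ‖v.2‖ = r ∧
    ∀ z ∈ L, z ≠ 0 → ‖z‖ ≤ r → ∃ α ∈ U4, z = α • u ∨ z = α • v}

/-- The full transversal `T'`. -/
def fullTransversal : Set (Set (ℂ × ℂ)) :=
  {L | L ∈ Omega1 ∧ ∃ u v : ℂ × ℂ, IsMinimalVector L u ∧ IsMinimalVector L v ∧ ∃ r : ℝ,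
    ‖u.2‖ < r ∧ ‖v.1‖ < r ∧ ‖u.1‖ = r ∧ ‖v.2‖ = r ∧
    ∀ z ∈ L, ‖z‖ < r → z = 0}

/-- The negligible set `𝒩` of unimodular lattices having a nonzero vector on a coordinate axis, or
two linearly independent vectors whose first, or whose second, coordinates have equal moduli. -/
def negligibleSet : Set (Set (ℂ × ℂ)) :=
  {L | L ∈ Omega1 ∧
    ((∃ u ∈ L, u ≠ 0 ∧ u.1 * u.2 = 0) ∨
      ∃ u ∈ L, ∃ v ∈ L, LinearIndependent ℂ ![u, v] ∧ (‖u.1‖ = ‖v.1‖ ∨ ‖u.2‖ = ‖v.2‖))}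

/-- The set of positive times at which the orbit of `L` meets the full transversal. -/
def returnTimes (L : Set (ℂ × ℂ)) : Set ℝ := {s | 0 < s ∧ flow s L ∈ fullTransversal}

/-- The first return time of `L` to the full transversal
(meaningful when `returnTimes L` has a least element). -/
def returnTime (L : Set (ℂ × ℂ)) : ℝ := sInf (returnTimes L)

/-- The first return map `R`. -/
def firstReturn (L : Set (ℂ × ℂ)) : Set (ℂ × ℂ) := flow (returnTime L) L

/-! ### The parametrizations `Ψ₁`, `Ψ₂` (the index `k` is `1` or `2`) -/

/-- The factor `r = k^{1/4} / √|1 - w₁ w₂|`. -/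
def radius (k : ℕ) (w : ℂ × ℂ) : ℝ := (k : ℝ) ^ (1 / 4 : ℝ) / Real.sqrt ‖1 - w.1 * w.2‖

/-- The unit complex number `u₁ = e^{iθ}`. -/
def unit1 (θ : ℝ) : ℂ := Complex.exp (Complex.I * θ)

/-- The unit complex number `v₂ = e^{i((k-1)π/4 - θ - arg (1 - w₁ w₂))}`. -/
def unit2 (k : ℕ) (θ : ℝ) (w : ℂ × ℂ) : ℂ :=
  Complex.exp (Complex.I *
    ((((k : ℝ) - 1) * (Real.pi / 4) - θ - Complex.arg (1 - w.1 * w.2) : ℝ) : ℂ))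

/-- The vector `u = r (u₁, v₂ w₂)`. -/
def vecU (k : ℕ) (θ : ℝ) (w : ℂ × ℂ) : ℂ × ℂ :=
  (radius k w : ℂ) • (unit1 θ, unit2 k θ w * w.2)

/-- The vector `v = r (u₁ w₁, v₂)`. -/
def vecV (k : ℕ) (θ : ℝ) (w : ℂ × ℂ) : ℂ × ℂ :=
  (radius k w : ℂ) • (unit1 θ * w.1, unit2 k θ w)

/-- `Ψ₁(θ,w) = ℤ[i] u + ℤ[i] v` and `Ψ₂(θ,w) = ℤ[i] u + ℤ[i] (u+v)/(1+i)`. -/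
def Psi (k : ℕ) (θ : ℝ) (w : ℂ × ℂ) : Set (ℂ × ℂ) :=
  if k = 2 then
    latticeSpan (vecU k θ w) ((1 / (1 + Complex.I)) • (vecU k θ w + vecV k θ w))
  else latticeSpan (vecU k θ w) (vecV k θ w)

/-! ### The parameter sets `W₁`, `W₂` and `W'₁`, `W'₂` -/

/-- `𝒞 = {|w| < 1, arg w ∈ [0, π/4]}`. -/
def setC : Set ℂ := {w | ‖w‖ < 1 ∧ Complex.arg w ∈ Set.Icc 0 (Real.pi / 4)}

/-- `𝒟 = {|w| < 1, d(w,1) > 1, d(w,1-i) > 1}`. -/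
def setD : Set ℂ := {w | ‖w‖ < 1 ∧ 1 < dist w 1 ∧ 1 < dist w (1 - Complex.I)}

/-- `𝒯 = {|w| < 1, d(w,1) > √2, d(w,-i) > √2}`. -/
def setT : Set ℂ :=
  {w | ‖w‖ < 1 ∧ Real.sqrt 2 < dist w 1 ∧ Real.sqrt 2 < dist w (-Complex.I)}

def red1 : Set ℂ := Metric.closedBall Complex.I 1
def red2 : Set ℂ := Metric.closedBall (-Complex.I) 1
def blue1 : Set ℂ := Metric.closedBall ((1 - Complex.I) / 2) (1 / Real.sqrt 2)
def blue2 : Set ℂ := Metric.closedBall (1 + Complex.I) 1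
def green1 : Set ℂ := Metric.closedBall (1 + Complex.I) 1
def green2 : Set ℂ := Metric.closedBall ((1 - Complex.I) / 2) (1 / Real.sqrt 2)

/-- The set `W₁⁰`. -/
def W10 : Set (ℂ × ℂ) :=
  {w | w.1 ∈ setC ∧ w.2 ∈ setD ∧
    ((w.2 ∈ green2 ∧ w.1 ∉ red1 ∪ green1) ∨
      (w.2 ∈ red2 \ green2 ∧ w.1 ∉ red1) ∨
      (w.2 ∉ red2 ∪ blue2 ∧ w.1 ≠ 0) ∨
      (w.2 ∈ blue2 ∧ w.1 ∉ blue1))}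

/-- The set `W₂⁰`. -/
def W20 : Set (ℂ × ℂ) :=
  (setC \ Metric.closedBall (-Complex.I) (Real.sqrt 2)) ×ˢ setT

/-- The group `𝔻₈` of isometries of `ℂ` generated by the multiplications by elements of `𝕌₄` and
by the conjugation; its eight elements are the maps `z ↦ ω z` and `z ↦ ω z̄` with `ω ∈ 𝕌₄`. -/
def D8 : Set (ℂ → ℂ) :=
  {φ | ∃ ω ∈ U4, (φ = fun z => ω * z) ∨ (φ = fun z => ω * (starRingEnd ℂ) z)}

/-- `W_k = {(φ(w₁), φ(1)⁻² φ(w₂)) : φ ∈ 𝔻₈, (w₁,w₂) ∈ W_k⁰}`. -/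
def W (k : ℕ) : Set (ℂ × ℂ) :=
  {w | ∃ φ ∈ D8, ∃ x ∈ (if k = 2 then W20 else W10), w = (φ x.1, 1 / (φ 1) ^ 2 * φ x.2)}

/-- `W'_k` is the set of `w ∈ W_k` with `Ψ_k(θ,w) ∉ 𝒩`. This condition does not depend on `θ`, as
`Ψ_k(θ,w) = diag (e^{iθ}, e^{-iθ}) Ψ_k(0,w)`. -/
def W' (k : ℕ) : Set (ℂ × ℂ) :=
  {w | w ∈ W k ∧ ∃ θ : ℝ, Psi k θ w ∉ negligibleSet}

/-! ### The map `T_G` -/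

/-- The lexicographic preorder `x ≺ y`: second moduli first. -/
def lexLE (x y : ℂ × ℂ) : Prop := ‖x.2‖ < ‖y.2‖ ∨ (‖x.2‖ = ‖y.2‖ ∧ ‖x.1‖ ≤ ‖y.1‖)

/-- The vector `-a (1, w₂) + g (w₁, 1)` if `k = 1`, and `-a (1 + w₁, w₂ + 1) + g (w₁, 1)` if
`k = 2`. -/
def nextVec (k : ℕ) (w : ℂ × ℂ) (p : ℂ × GaussianInt) : ℂ × ℂ :=
  if k = 2 then -p.1 • ((1 + w.1, w.2 + 1) : ℂ × ℂ) + (p.2 : ℂ) • ((w.1, 1) : ℂ × ℂ)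
  else -p.1 • ((1, w.2) : ℂ × ℂ) + (p.2 : ℂ) • ((w.1, 1) : ℂ × ℂ)

/-- The pairs `(a, g)` that compete in the definition of `T_G`:
`a ∈ {1, 1+i}` and `|a/w₁ - g| < 1` if `k = 1`;
`a = 1/(1+i)` and `|1/((1+i)w₁) + 1/(1+i) - g| < 1` if `k = 2`. -/
def candidates (k : ℕ) (w : ℂ × ℂ) : Set (ℂ × GaussianInt) :=
  if k = 2 then {p | p.1 = 1 / (1 + Complex.I) ∧ ‖p.1 / w.1 + p.1 - (p.2 : ℂ)‖ < 1}
  else {p | (p.1 = 1 ∨ p.1 = 1 + Complex.I) ∧ ‖p.1 / w.1 - (p.2 : ℂ)‖ < 1}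

/-- The pair `(a, g)` is a candidate whose vector is minimal for the preorder `≺` among the vectors
of all the candidates. -/
def IsMinimalCoeff (k : ℕ) (w : ℂ × ℂ) (p : ℂ × GaussianInt) : Prop :=
  p ∈ candidates k w ∧
    ∀ q ∈ candidates k w, lexLE (nextVec k w q) (nextVec k w p) →
      lexLE (nextVec k w p) (nextVec k w q)

/-- The minimal pair `(a, g)` (meaningful when there is exactly one). -/
def coeff (k : ℕ) (w : ℂ × ℂ) : ℂ × GaussianInt := Classical.epsilon (IsMinimalCoeff k w)

/-- The coefficient `a_k(w₁,w₂)`. -/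
def coeffA (k : ℕ) (w : ℂ × ℂ) : ℂ := (coeff k w).1

/-- The Gaussian integer `g`, as a complex number. -/
def coeffG (k : ℕ) (w : ℂ × ℂ) : ℂ := ((coeff k w).2 : ℂ)

/-- The map `T_G` on the `k`-th component:
`(g - a/w₁, 1/(g - a w₂))` if `k = 1`, and `(g - a/w₁ - a, 1/(g - a w₂ - a))`, where
`a = 1/(1+i)`, if `k = 2`. -/
def TG (k : ℕ) (w : ℂ × ℂ) : ℂ × ℂ :=
  if k = 2 then
    (coeffG k w - coeffA k w / w.1 - coeffA k w,
      1 / (coeffG k w - coeffA k w * w.2 - coeffA k w))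
  else (coeffG k w - coeffA k w / w.1, 1 / (coeffG k w - coeffA k w * w.2))

/-- `α ∈ 𝕌₄` and `θ' ∈ [0, π/2[` satisfy `θ' = θ + arg w₁ + arg α` modulo `2π`. -/
def IsAngleChoice (θ : ℝ) (w₁ α : ℂ) (θ' : ℝ) : Prop :=
  α ∈ U4 ∧ θ' ∈ Set.Ico 0 (Real.pi / 2) ∧
    ∃ n : ℤ, θ' = θ + Complex.arg w₁ + Complex.arg α + 2 * Real.pi * n

end GaussLattice

end

/-! A diagonal scaling turns `vecU`, `vecV` into U = (1, w₂), V = (w₁, 1), and the lattice into the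
span of V and b, where b is U for k = 1 and (U + V)/(1 + i) for k = 2. Two facts carry the proof.
First, the nonzero vectors of the closed unit box are unit multiples of U or V
(`Reduced.eq_unit_smul`). Secondly, among the nonzero vectors whose first modulus is less than |w₁|,
the least second modulus is attained by a vector X competing for T_G
(`Reduced.exists_candidate_le`). The flow returns when the images of V and X first bound a common
square box (`isLeast_returnTimes`), so the return map replaces the pair (U, V) by (V, X).

Both facts concern infinitely many Gaussian coefficients. They become finite through
`exists_short_remainder`: if a and g are coprime and N(a) ≥ 4, some remainder r of g modulo a
satisfies 1 + |r| ≤ |a|. The extra 1 absorbs a triangle inequality, so a large coefficient can be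
replaced by a unit without lengthening the vector beyond the bound in question. Coefficients of norm
1 and 2 remain, whence a ∈ {1, 1 + i}. The disks in the definition of W_k⁰ settle these cases, and
the symmetries transport the result to W_k.

Avoiding 𝒩 makes the minimal competitor unique. Since det(V, X) = a(1 − w₁w₂), the coefficient a
decides whether the new pair is a basis or spans a submodule of index two. Finally both sides of the
formula are diagonal images of one normalized lattice. The diagonal matrices agree because their
entries are balanced, their first entries have the same phase and their determinants are equal
(`eq_and_eq_of_mul_eq`). Moving the angle into [0, π/2[ costs the matrix diag(α⁻¹, α), which acts on
the parameters as α² (`scale_normLattice_unit`). -/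

namespace GaussLattice

/-! ### Gaussian integers -/

theorem norm_coe_sq (x : GaussianInt) : ‖(x : ℂ)‖ ^ 2 = (x.norm : ℝ) := by
  rw [GaussianInt.intCast_real_norm, Complex.normSq_eq_norm_sq]

theorem norm_eq_re_im (x : GaussianInt) : x.norm = x.re ^ 2 + x.im ^ 2 := by
  rw [Zsqrtd.norm_def]; ring

theorem one_le_norm_coe {x : GaussianInt} (hx : x ≠ 0) : 1 ≤ ‖(x : ℂ)‖ := by
  have h : (1 : ℝ) ≤ (x.norm : ℝ) := by exact_mod_cast GaussianInt.norm_pos.2 hx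
  rw [← norm_coe_sq] at h
  nlinarith [norm_nonneg (x : ℂ)]

theorem norm_coe_of_norm_eq_one {x : GaussianInt} (hx : x.norm = 1) : ‖(x : ℂ)‖ = 1 := by
  have h := norm_coe_sq x
  rw [hx] at h
  have := norm_nonneg (x : ℂ)
  push_cast at h
  nlinarith

theorem le_norm_coe {x : GaussianInt} {c : ℝ} (h : c ^ 2 ≤ x.norm) : c ≤ ‖(x : ℂ)‖ := by
  rw [← norm_coe_sq] at h
  exact (abs_le_of_sq_le_sq' h (norm_nonneg _)).2

theorem norm_coe_le {x : GaussianInt} {c : ℝ} (hc : 0 ≤ c) (h : x.norm ≤ c ^ 2) :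
    ‖(x : ℂ)‖ ≤ c := by
  rw [← norm_coe_sq] at h
  exact abs_le_of_sq_le_sq' h hc |>.2

/-- Every complex number is at distance at most `1/√2` from a Gaussian integer. -/
theorem exists_near (z : ℂ) : ∃ n : GaussianInt, ‖z - n‖ ^ 2 ≤ 1 / 2 := by
  refine ⟨⟨round z.re, round z.im⟩, ?_⟩
  rw [← Complex.normSq_eq_norm_sq, Complex.normSq_apply]
  have h1 := abs_le.1 (abs_sub_round z.re)
  have h2 := abs_le.1 (abs_sub_round z.im)
  simp only [Complex.sub_re, Complex.sub_im, GaussianInt.re_toComplex, GaussianInt.im_toComplex]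
  nlinarith

theorem exists_remainder (a g : GaussianInt) (ha : a ≠ 0) :
    ∃ n : GaussianInt, 2 * (g - n * a).norm ≤ a.norm := by
  obtain ⟨n, hn⟩ := exists_near ((g : ℂ) / a)
  refine ⟨n, ?_⟩
  have ha' : (a : ℂ) ≠ 0 := by simpa using ha
  have h : ((g - n * a : GaussianInt) : ℂ) = ((g : ℂ) / a - n) * a := by
    rw [sub_mul, div_mul_cancel₀ _ ha']; simp
  have h2 : ((2 * (g - n * a).norm : ℤ) : ℝ) ≤ a.norm := by
    push_cast
    rw [← norm_coe_sq, ← norm_coe_sq, h, norm_mul, mul_pow]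
    nlinarith [sq_nonneg ‖(a : ℂ)‖]
  exact_mod_cast h2

set_option synthInstance.maxSize 2000 in
set_option synthInstance.maxHeartbeats 200000 in
-- The finite check behind `exists_short_remainder`, with a = x + iy and r = s + it. The first three
-- cases give 1 + |r| ≤ |a| at once; in the fifth, subtracting a unit multiple of a leaves a
-- remainder of norm 1; the fourth and the sixth contradict coprimality.
theorem small_remainders :
    ∀ x ∈ Finset.Icc (-3 : ℤ) 3, ∀ y ∈ Finset.Icc (-3 : ℤ) 3,
    ∀ s ∈ Finset.Icc (-2 : ℤ) 2, ∀ t ∈ Finset.Icc (-2 : ℤ) 2,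
    4 ≤ x ^ 2 + y ^ 2 → x ^ 2 + y ^ 2 ≤ 11 → 2 * (s ^ 2 + t ^ 2) ≤ x ^ 2 + y ^ 2 →
      (s ^ 2 + t ^ 2 = 0) ∨
      (s ^ 2 + t ^ 2 = 1) ∨ (s ^ 2 + t ^ 2 ≤ 4 ∧ 9 ≤ x ^ 2 + y ^ 2) ∨
      ((s + t) % 2 = 0 ∧ (x + y) % 2 = 0) ∨
      (∃ e ∈ [((1 : ℤ), (0 : ℤ)), (-1, 0), (0, 1), (0, -1)],
        (s - (e.1 * x - e.2 * y)) ^ 2 + (t - (e.1 * y + e.2 * x)) ^ 2 = 1) ∨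
      (∃ e ∈ [((1 : ℤ), (1 : ℤ)), (-1, 1), (1, -1), (-1, -1)],
        x = e.1 * s - e.2 * t ∧ y = e.1 * t + e.2 * s ∧ 4 ≤ s ^ 2 + t ^ 2) := by
  decide +kernel

/-- The prime `1 + i`. -/
def onePlusI : GaussianInt := ⟨1, 1⟩

theorem onePlusI_coe : (onePlusI : ℂ) = 1 + Complex.I := by
  simp [onePlusI, GaussianInt.toComplex_def]

theorem norm_onePlusI : onePlusI.norm = 2 := by decide

theorem norm_one_add_I : ‖1 + Complex.I‖ = √2 := by
  rw [← onePlusI_coe, eq_comm, Real.sqrt_eq_iff_mul_self_eq (by norm_num) (norm_nonneg _), ← sq,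
    norm_coe_sq, norm_onePlusI]
  norm_num

theorem one_add_I_ne_zero : 1 + Complex.I ≠ 0 := by
  rw [← norm_pos_iff, norm_one_add_I]; positivity

theorem onePlusI_dvd_iff (x : GaussianInt) : onePlusI ∣ x ↔ (x.re + x.im) % 2 = 0 := by
  constructor
  · rintro ⟨y, rfl⟩
    simp [onePlusI]; omega
  · intro h
    refine ⟨⟨(x.re + x.im) / 2, (x.im - x.re) / 2⟩, ?_⟩
    ext <;> simp [onePlusI] <;> omega

theorem not_isUnit_of_one_lt_norm {x : GaussianInt} (h : 1 < x.norm) : ¬ IsUnit x := by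
  rw [← Zsqrtd.norm_eq_one_iff]; omega

theorem isCoprime_onePlusI {x : GaussianInt} (h : ¬ onePlusI ∣ x) : IsCoprime x onePlusI := by
  rw [onePlusI_dvd_iff] at h
  have : onePlusI ∣ x - 1 := by
    rw [onePlusI_dvd_iff]; simp; omega
  obtain ⟨y, hy⟩ := this
  exact ⟨1, -y, by linear_combination hy⟩

/-- Division with a remainder that is shorter by one than the divisor. -/
theorem exists_short_remainder {a g : GaussianInt} (h : IsCoprime a g) (ha : 4 ≤ a.norm) :
    ∃ n : GaussianInt, 1 + ‖((g - n * a : GaussianInt) : ℂ)‖ ≤ ‖(a : ℂ)‖ := by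
  have ha0 : a ≠ 0 := by rintro rfl; simp at ha
  obtain ⟨n, hn⟩ := exists_remainder a g ha0
  have hc : IsCoprime a (g - n * a) := by
    simpa [sub_eq_add_neg, mul_comm] using h.add_mul_left_right (-n)
  set r := g - n * a with hr
  have key : ∀ (n : GaussianInt) (c : ℝ), 0 ≤ c → ((g - n * a).norm : ℝ) ≤ c ^ 2 →
      (1 + c) ^ 2 ≤ a.norm → 1 + ‖((g - n * a : GaussianInt) : ℂ)‖ ≤ ‖(a : ℂ)‖ := by
    intro n c hc h1 h2
    linarith [le_norm_coe h2, norm_coe_le hc h1]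
  -- For N(a) ≥ 12 the bound |r| ≤ |a|/√2 suffices, because (1 − 1/√2)√12 > 1.
  rcases le_or_gt a.norm 11 with h11 | h12
  · have e1 := norm_eq_re_im a
    have e2 := norm_eq_re_im r
    rw [e1] at h11 ha hn
    rw [e2] at hn
    have ha' : ((a.re ^ 2 + a.im ^ 2 : ℤ) : ℝ) ≥ 4 := by exact_mod_cast ha
    rcases small_remainders a.re (Finset.mem_Icc.2 ⟨by nlinarith, by nlinarith⟩)
      a.im (Finset.mem_Icc.2 ⟨by nlinarith, by nlinarith⟩)
      r.re (Finset.mem_Icc.2 ⟨by nlinarith, by nlinarith⟩)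
      r.im (Finset.mem_Icc.2 ⟨by nlinarith, by nlinarith⟩) ha h11 hn with
      h0 | h1 | ⟨h4, h9⟩ | ⟨ho1, ho2⟩ | ⟨e, -, he⟩ | ⟨e, -, he1, he2, he3⟩
    · refine ⟨n, key n 0 le_rfl ?_ ?_⟩
      · rw [← hr, e2, h0]; norm_num
      · rw [e1]; linarith
    · refine ⟨n, key n 1 zero_le_one ?_ ?_⟩
      · rw [← hr, e2, h1]; norm_num
      · rw [e1]; linarith
    · refine ⟨n, key n 2 zero_le_two ?_ ?_⟩
      · rw [← hr, e2, show (2 : ℝ) ^ 2 = ((4 : ℤ) : ℝ) by norm_num]; exact_mod_cast h4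
      · rw [e1, show (1 + 2 : ℝ) ^ 2 = ((9 : ℤ) : ℝ) by norm_num]; exact_mod_cast h9
    · exact absurd (hc.isUnit_of_dvd' ((onePlusI_dvd_iff _).2 ho2) ((onePlusI_dvd_iff _).2 ho1))
        (not_isUnit_of_one_lt_norm (by rw [norm_onePlusI]; norm_num))
    · refine ⟨n + ⟨e.1, e.2⟩, key _ 1 zero_le_one ?_ ?_⟩
      · have : g - (n + ⟨e.1, e.2⟩) * a = r - ⟨e.1, e.2⟩ * a := by rw [hr]; ring
        rw [this, norm_eq_re_im]
        simp only [Zsqrtd.re_sub, Zsqrtd.im_sub, Zsqrtd.re_mul, Zsqrtd.im_mul]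
        have he' : (r.re - (e.1 * a.re + -1 * e.2 * a.im)) ^ 2 +
          (r.im - (e.1 * a.im + e.2 * a.re)) ^ 2 = 1 := by linear_combination he
        rw [he']; norm_num
      · rw [e1]; linarith
    · have hd : r ∣ a := ⟨⟨e.1, e.2⟩, by
        ext
        · rw [he1]; simp; ring
        · rw [he2]; simp; ring⟩
      exact absurd (hc.isUnit_of_dvd' hd dvd_rfl) (not_isUnit_of_one_lt_norm (by rw [e2]; omega))
  · refine ⟨n, ?_⟩
    have h1 : (2 : ℝ) * ‖(r : ℂ)‖ ^ 2 ≤ ‖(a : ℂ)‖ ^ 2 := by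
      rw [norm_coe_sq, norm_coe_sq]; exact_mod_cast hn
    have h2 : (12 : ℝ) ≤ ‖(a : ℂ)‖ ^ 2 := by rw [norm_coe_sq]; exact_mod_cast h12
    have h3 := norm_nonneg (a : ℂ)
    have h4 := norm_nonneg (r : ℂ)
    have h5 : (3.45 : ℝ) ≤ ‖(a : ℂ)‖ := by nlinarith
    rw [← hr]
    by_contra! hcon
    nlinarith

/-- Removal of the common factor of a pair of Gaussian integers. -/
theorem exists_isCoprime {p q : GaussianInt} (h : p ≠ 0) :
    ∃ d p' q', d ≠ 0 ∧ p = d * p' ∧ q = d * q' ∧ IsCoprime p' q' := by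
  have hg : EuclideanDomain.gcd p q ≠ 0 := fun h0 => h (EuclideanDomain.gcd_eq_zero_iff.1 h0).1
  obtain ⟨p', hp⟩ := EuclideanDomain.gcd_dvd_left p q
  obtain ⟨q', hq⟩ := EuclideanDomain.gcd_dvd_right p q
  refine ⟨_, p', q', hg, hp, hq, ?_⟩
  have hb := EuclideanDomain.gcd_eq_gcd_ab p q
  refine ⟨EuclideanDomain.gcdA p q, EuclideanDomain.gcdB p q, mul_left_cancel₀ hg ?_⟩
  linear_combination -hb - EuclideanDomain.gcdA p q * hp - EuclideanDomain.gcdB p q * hq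

/-! ### Short vectors in a lattice with a reduced basis -/

theorem norm_eq_one_or_dvd {x : GaussianInt} (hx : x.norm ≤ 3) : x.norm = 1 ∨ onePlusI ∣ x := by
  rw [onePlusI_dvd_iff]
  rw [norm_eq_re_im] at *
  have h1 : -1 ≤ x.re := by nlinarith [sq_nonneg x.im]
  have h2 : x.re ≤ 1 := by nlinarith [sq_nonneg x.im]
  have h3 : -1 ≤ x.im := by nlinarith [sq_nonneg x.re]
  have h4 : x.im ≤ 1 := by nlinarith [sq_nonneg x.re]
  generalize x.re = a at *
  generalize x.im = b at *
  interval_cases a <;> interval_cases b <;> simp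

theorem mul_star_of_norm_eq_one {q : GaussianInt} (hq : q.norm = 1) : q * star q = 1 := by
  have h := Zsqrtd.norm_eq_mul_conj q
  rw [hq] at h
  exact_mod_cast h.symm

theorem norm_star_mul {q : GaussianInt} (hq : q.norm = 1) (p : GaussianInt) :
    (star q * p).norm = p.norm := by
  rw [Zsqrtd.norm_mul, Zsqrtd.norm_conj, hq, one_mul]

section

variable {E : Type*} [NormedAddCommGroup E] [NormedSpace ℂ E] {u v : E}

theorem norm_lincomb_of_unit {q : GaussianInt} (hq : q.norm = 1) (p : GaussianInt) :
    ‖(p : ℂ) • u + (q : ℂ) • v‖ = ‖((star q * p : GaussianInt) : ℂ) • u + v‖ := by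
  have h : (p : ℂ) • u + (q : ℂ) • v = (q : ℂ) • (((star q * p : GaussianInt) : ℂ) • u + v) := by
    rw [smul_add, smul_smul, ← map_mul, ← mul_assoc, mul_star_of_norm_eq_one hq, one_mul]
  rw [h, norm_smul, norm_coe_of_norm_eq_one hq, one_mul]

/-- Reduces the coefficient q to 1. Take a short remainder r of p/d modulo q; then q(nu + v) = (pu +
qv) − dru has norm at most |d|(1 + |r|) ≤ |d||q|. The value d = 1 serves the threshold 1, and d = 1
+ i serves the threshold √2. -/
theorem exists_shorter {p q d : GaussianInt} (hu : ‖u‖ ≤ 1) (hqp : IsCoprime q p)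
    (hqd : IsCoprime q d) (hq : 4 ≤ q.norm) (hz : ‖(p : ℂ) • u + (q : ℂ) • v‖ ≤ ‖(d : ℂ)‖) :
    ∃ n r : GaussianInt, p = n * q + d * r ∧ 1 + ‖(r : ℂ)‖ ≤ ‖(q : ℂ)‖ ∧
      ‖(n : ℂ) • u + v‖ ≤ ‖(d : ℂ)‖ := by
  obtain ⟨a, b, hab⟩ := hqd
  have hqb : IsCoprime q b := ⟨a, d, by rw [← hab]; ring⟩
  obtain ⟨m, hm⟩ := exists_short_remainder (hqb.mul_right hqp) hq
  have hp : p = (p * a + d * m) * q + d * (b * p - m * q) := by linear_combination -p * hab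
  refine ⟨p * a + d * m, b * p - m * q, hp, hm, ?_⟩
  generalize p * a + d * m = n at *
  generalize b * p - m * q = r at *
  have hq0 : 0 < ‖(q : ℂ)‖ := by linarith [norm_nonneg (r : ℂ)]
  have h : (q : ℂ) • ((n : ℂ) • u + v) = ((p : ℂ) • u + (q : ℂ) • v) - ((d : ℂ) * r) • u := by
    rw [hp, map_add, map_mul, map_mul]; module
  have h1 : ‖(q : ℂ)‖ * ‖(n : ℂ) • u + v‖ ≤ ‖(q : ℂ)‖ * ‖(d : ℂ)‖ := by
    rw [← norm_smul, h]
    refine (norm_sub_le _ _).trans ?_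
    rw [norm_smul, norm_mul]
    have := mul_nonneg (norm_nonneg (d : ℂ)) (norm_nonneg (r : ℂ))
    nlinarith [norm_nonneg (d : ℂ)]
  exact le_of_mul_le_mul_left h1 hq0

/-- Otherwise `exists_shorter` gives ‖nu + v‖ ≤ 1. Here n = 0 would mean p = r with |q| − |p| ≥ 1,
against `h1`, and `h2` forces |n| < 2, so `h` applies. -/
theorem one_lt_norm_of_four_le {p q : GaussianInt} (hu : ‖u‖ ≤ 1)
    (h1 : ∀ c d : ℂ, c ≠ 0 → ‖d‖ - ‖c‖ < ‖c • u + d • v‖)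
    (h2 : ∀ c d : ℂ, d ≠ 0 → ‖c‖ - ‖d‖ < ‖c • u + d • v‖)
    (h : ∀ n : GaussianInt, n ≠ 0 → n.norm ≤ 3 → 1 < ‖(n : ℂ) • u + v‖)
    (hqp : IsCoprime q p) (hp : p ≠ 0) (hq : 4 ≤ q.norm) : 1 < ‖(p : ℂ) • u + (q : ℂ) • v‖ := by
  by_contra! hz
  obtain ⟨n, r, hn, hr, hs⟩ :=
    exists_shorter (d := 1) hu hqp isCoprime_one_right hq (by simpa using hz)
  simp only [map_one, norm_one, one_mul] at hn hs
  have hn0 : n ≠ 0 := by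
    rintro rfl
    have := h1 p q (by simpa using hp)
    rw [zero_mul, zero_add] at hn
    rw [← hn] at hr
    linarith
  have h3 := h2 n 1 one_ne_zero
  rw [one_smul, norm_one] at h3
  have h4 : n.norm < 4 := by
    have : (n.norm : ℝ) < 4 := by
      rw [← norm_coe_sq]
      nlinarith [norm_nonneg (n : ℂ)]
    exact_mod_cast this
  linarith [h n hn0 (by omega)]

/-- Removing the common factor does not lengthen the vector. If both coefficients then have norm at
most 3, one is a unit, since otherwise both are divisible by 1 + i. -/
theorem one_lt_norm_of_reduced {p q : GaussianInt} (hu : ‖u‖ ≤ 1) (hv : ‖v‖ ≤ 1)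
    (h1 : ∀ c d : ℂ, c ≠ 0 → ‖d‖ - ‖c‖ < ‖c • u + d • v‖)
    (h2 : ∀ c d : ℂ, d ≠ 0 → ‖c‖ - ‖d‖ < ‖c • u + d • v‖)
    (h : ∀ n : GaussianInt, n ≠ 0 → n.norm ≤ 3 →
      1 < ‖(n : ℂ) • u + v‖ ∧ 1 < ‖u + (n : ℂ) • v‖)
    (hp : p ≠ 0) (hq : q ≠ 0) : 1 < ‖(p : ℂ) • u + (q : ℂ) • v‖ := by
  obtain ⟨d, p, q, hd, rfl, rfl, hc⟩ := exists_isCoprime (q := q) hp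
  have hp' : p ≠ 0 := right_ne_zero_of_mul hp
  have hq' : q ≠ 0 := right_ne_zero_of_mul hq
  suffices hs : 1 < ‖(p : ℂ) • u + (q : ℂ) • v‖ by
    rw [map_mul, map_mul, mul_smul, mul_smul, ← smul_add, norm_smul]
    nlinarith [one_le_norm_coe hd]
  rcases le_or_gt 4 q.norm with hq4 | hq4
  · exact one_lt_norm_of_four_le hu h1 h2 (fun n hn hn3 => (h n hn hn3).1) hc.symm hp' hq4
  rcases le_or_gt 4 p.norm with hp4 | hp4
  · rw [add_comm]
    refine one_lt_norm_of_four_le hv (fun c d hc => ?_) (fun c d hd => ?_)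
      (fun n hn hn3 => ?_) hc hq' hp4
    · rw [add_comm]; exact h2 d c hc
    · rw [add_comm]; exact h1 d c hd
    · rw [add_comm]; exact (h n hn hn3).2
  rcases norm_eq_one_or_dvd (x := q) (by omega) with hq1 | hqd
  · rw [norm_lincomb_of_unit hq1]
    refine (h _ ?_ ?_).1
    · rw [← GaussianInt.norm_pos, norm_star_mul hq1]; exact GaussianInt.norm_pos.2 hp'
    · rw [norm_star_mul hq1]; omega
  rcases norm_eq_one_or_dvd (x := p) (by omega) with hp1 | hpd
  · rw [add_comm, norm_lincomb_of_unit hp1, add_comm]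
    refine (h _ ?_ ?_).2
    · rw [← GaussianInt.norm_pos, norm_star_mul hp1]; exact GaussianInt.norm_pos.2 hq'
    · rw [norm_star_mul hp1]; omega
  · exact absurd (hc.isUnit_of_dvd' hpd hqd)
      (not_isUnit_of_one_lt_norm (by rw [norm_onePlusI]; norm_num))

theorem norm_onePlusI_coe : ‖(onePlusI : ℂ)‖ = √2 := by rw [onePlusI_coe, norm_one_add_I]

/-- Call odd what 1 + i does not divide. Descent with d = 1 + i preserves oddness, as p = nq + (1 +
i)r. One descent brings q to 1; another, with u and v exchanged, brings the remaining coefficient to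
a unit. -/
theorem sqrt_two_lt_norm_of_odd {p q : GaussianInt} (hu : ‖u‖ ≤ 1) (hv : ‖v‖ ≤ 1)
    (h : ∀ n : GaussianInt, n.norm = 1 → √2 < ‖(n : ℂ) • u + v‖)
    (hp : ¬ onePlusI ∣ p) (hq : ¬ onePlusI ∣ q) : √2 < ‖(p : ℂ) • u + (q : ℂ) • v‖ := by
  have s1 : (1 : ℝ) < √2 := by rw [Real.lt_sqrt] <;> norm_num
  have s2 : √2 ^ 2 = 2 := Real.sq_sqrt (by norm_num)
  have key : ∀ n : GaussianInt, ¬ onePlusI ∣ n → √2 < ‖(n : ℂ) • u + v‖ := by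
    intro n hn
    rcases le_or_gt 4 n.norm with h4 | h4
    · by_contra! hcon
      obtain ⟨m, r, hm, hr, hs⟩ := exists_shorter (u := v) (v := u) (p := 1) (q := n)
        (d := onePlusI) hv isCoprime_one_right (isCoprime_onePlusI hn) h4
        (by rw [norm_onePlusI_coe, map_one, one_smul, add_comm]; exact hcon)
      have hm2 : ¬ onePlusI ∣ m := by
        rintro ⟨y, rfl⟩
        have hd : onePlusI ∣ 1 := ⟨y * n + r, by linear_combination hm⟩
        exact not_isUnit_of_one_lt_norm (by rw [norm_onePlusI]; norm_num) (isUnit_of_dvd_one hd)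
      -- Since |r| ≤ |n| − 1, this gives |m||n| < √2|n|, so the odd number m is a unit.
      have hmn : ‖(m : ℂ)‖ * ‖(n : ℂ)‖ ≤ 1 + √2 * ‖(r : ℂ)‖ := by
        have e : ((m : ℂ)) * n = 1 - onePlusI * r := by
          rw [← map_mul, ← map_mul, ← map_one GaussianInt.toComplex, ← map_sub]
          congr 1; linear_combination -hm
        rw [← norm_mul, e, ← norm_onePlusI_coe, ← norm_mul]
        simpa using norm_sub_le (1 : ℂ) (onePlusI * r)
      have hm3 : m.norm ≤ 3 := by
        have : ‖(m : ℂ)‖ < √2 := by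
          by_contra! hc
          nlinarith [norm_nonneg (r : ℂ), norm_nonneg (n : ℂ)]
        have : (m.norm : ℝ) < 2 := by
          rw [← norm_coe_sq]; nlinarith [norm_nonneg (m : ℂ)]
        have : m.norm < 2 := by exact_mod_cast this
        omega
      have hm1 := (norm_eq_one_or_dvd hm3).resolve_right hm2
      have hx := norm_lincomb_of_unit (u := u) (v := v) hm1 1
      rw [map_one, one_smul, mul_one] at hx
      have := h (star m) (by rw [Zsqrtd.norm_conj, hm1])
      rw [← hx, add_comm] at this
      rw [norm_onePlusI_coe] at hs
      linarith
    · exact h n ((norm_eq_one_or_dvd (by omega)).resolve_right hn)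
  have hp0 : p ≠ 0 := by rintro rfl; simp at hp
  obtain ⟨d, p, q, hd, rfl, rfl, hc⟩ := exists_isCoprime (q := q) hp0
  have hp' : ¬ onePlusI ∣ p := fun hx => hp (hx.mul_left _)
  have hq' : ¬ onePlusI ∣ q := fun hx => hq (hx.mul_left _)
  suffices hs : √2 < ‖(p : ℂ) • u + (q : ℂ) • v‖ by
    rw [map_mul, map_mul, mul_smul, mul_smul, ← smul_add, norm_smul]
    nlinarith [one_le_norm_coe hd]
  rcases le_or_gt 4 q.norm with hq4 | hq4
  · by_contra! hcon
    obtain ⟨n, r, hn, hr, hs⟩ := exists_shorter (d := onePlusI) hu hc.symm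
      (isCoprime_onePlusI hq') hq4 (by rwa [norm_onePlusI_coe])
    have hn2 : ¬ onePlusI ∣ n := by
      rintro ⟨y, rfl⟩
      exact hp' ⟨y * q + r, by linear_combination hn⟩
    have := key n hn2
    rw [norm_onePlusI_coe] at hs
    linarith
  · have hq1 := (norm_eq_one_or_dvd (by omega)).resolve_right hq'
    rw [norm_lincomb_of_unit hq1]
    refine key _ ?_
    rintro ⟨y, hy⟩
    refine hp' ⟨q * y, ?_⟩
    linear_combination q * hy - p * mul_star_of_norm_eq_one hq1

/-- For n = (1 + i)e with e a unit, nu + v = (1 + i)(eu + v) − iv has norm greater than √2·√2 − 1.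
-/
theorem one_lt_norm_of_unit_combinations (hv : ‖v‖ ≤ 1)
    (h : ∀ n : GaussianInt, n.norm = 1 → √2 < ‖(n : ℂ) • u + v‖)
    {n : GaussianInt} (hn0 : n ≠ 0) (hn : n.norm ≤ 3) :
    1 < ‖(n : ℂ) • u + v‖ := by
  have s1 : (1 : ℝ) < √2 := by rw [Real.lt_sqrt] <;> norm_num
  have s2 : √2 ^ 2 = 2 := Real.sq_sqrt (by norm_num)
  rcases norm_eq_one_or_dvd hn with h1 | ⟨e, rfl⟩
  · exact s1.trans (h n h1)
  · have he0 : e ≠ 0 := right_ne_zero_of_mul hn0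
    have he : e.norm = 1 := by
      have := GaussianInt.norm_pos.2 he0
      rw [Zsqrtd.norm_mul, norm_onePlusI] at hn
      omega
    have hx : (onePlusI : ℂ) • ((e : ℂ) • u + v) =
        (((onePlusI * e : GaussianInt) : ℂ) • u + v) + Complex.I • v := by
      rw [map_mul, onePlusI_coe]; module
    have hy := norm_add_le (((onePlusI * e : GaussianInt) : ℂ) • u + v) (Complex.I • v)
    rw [← hx, norm_smul, norm_smul, norm_onePlusI_coe, Complex.norm_I, one_mul] at hy
    nlinarith [h e he]

end

/-! ### Normalized lattices -/

/-- The first vector of a normalized pair. -/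
noncomputable def baseU (w : ℂ × ℂ) : ℂ × ℂ := (1, w.2)

/-- The second vector of a normalized pair. -/
noncomputable def baseV (w : ℂ × ℂ) : ℂ × ℂ := (w.1, 1)

/-- The vector that completes `baseV w` to a basis of the normalized lattice. -/
noncomputable def baseB (k : ℕ) (w : ℂ × ℂ) : ℂ × ℂ :=
  if k = 2 then (1 / (1 + Complex.I)) • (baseU w + baseV w) else baseU w

/-- The lattice `Ψ_k(θ,w)` up to a diagonal matrix. -/
noncomputable def normLattice (k : ℕ) (w : ℂ × ℂ) : Set (ℂ × ℂ) := latticeSpan (baseB k w) (baseV w)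

theorem lincomb_mem_latticeSpan (g h : GaussianInt) (u v : ℂ × ℂ) :
    (g : ℂ) • u + (h : ℂ) • v ∈ latticeSpan u v := ⟨g, h, rfl⟩

theorem smul_mem_latticeSpan {u v z : ℂ × ℂ} (n : GaussianInt) (hz : z ∈ latticeSpan u v) :
    (n : ℂ) • z ∈ latticeSpan u v := by
  obtain ⟨g, h, rfl⟩ := hz
  exact ⟨n * g, n * h, by simp only [map_mul]; module⟩

theorem add_mem_latticeSpan {u v z z' : ℂ × ℂ} (hz : z ∈ latticeSpan u v)
    (hz' : z' ∈ latticeSpan u v) : z + z' ∈ latticeSpan u v := by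
  obtain ⟨g, h, rfl⟩ := hz
  obtain ⟨g', h', rfl⟩ := hz'
  exact ⟨g + g', h + h', by simp only [map_add]; module⟩

theorem left_mem_latticeSpan (u v : ℂ × ℂ) : u ∈ latticeSpan u v := ⟨1, 0, by simp⟩

theorem right_mem_latticeSpan (u v : ℂ × ℂ) : v ∈ latticeSpan u v := ⟨0, 1, by simp⟩

theorem latticeSpan_subset {u v u' v' : ℂ × ℂ} (hu : u ∈ latticeSpan u' v')
    (hv : v ∈ latticeSpan u' v') : latticeSpan u v ⊆ latticeSpan u' v' := by
  rintro _ ⟨g, h, rfl⟩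
  exact add_mem_latticeSpan (smul_mem_latticeSpan g hu) (smul_mem_latticeSpan h hv)

theorem coe_mem_U4 {n : GaussianInt} (hn : n.norm = 1) : (n : ℂ) ∈ U4 := by
  have h : n ^ 4 = 1 := by
    rcases norm_eq_re_im n ▸ hn with h
    have h1 : -1 ≤ n.re := by nlinarith [sq_nonneg n.im]
    have h2 : n.re ≤ 1 := by nlinarith [sq_nonneg n.im]
    have h3 : -1 ≤ n.im := by nlinarith [sq_nonneg n.re]
    have h4 : n.im ≤ 1 := by nlinarith [sq_nonneg n.re]
    obtain ⟨a, b⟩ := n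
    simp only at h h1 h2 h3 h4
    interval_cases a <;> interval_cases b <;> first | omega | decide
  change (n : ℂ) ^ 4 = 1
  rw [← map_pow, h, map_one]

theorem norm_of_mem_U4 {α : ℂ} (h : α ∈ U4) : ‖α‖ = 1 := by
  have h : α ^ 4 = 1 := h
  exact Complex.norm_eq_one_of_pow_eq_one h (by norm_num)

theorem eq_of_mem_U4 {α : ℂ} (h : α ∈ U4) :
    α = 1 ∨ α = -1 ∨ α = Complex.I ∨ α = -Complex.I := by
  have h : α ^ 4 = 1 := h
  have hf : (α - 1) * ((α + 1) * ((α - Complex.I) * (α + Complex.I))) = 0 := by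
    linear_combination h - (α ^ 2 - 1) * Complex.I_sq
  simp only [mul_eq_zero] at hf
  rcases hf with h | h | h | h
  · exact Or.inl (sub_eq_zero.1 h)
  · exact Or.inr (Or.inl (eq_neg_of_add_eq_zero_left h))
  · exact Or.inr (Or.inr (Or.inl (sub_eq_zero.1 h)))
  · exact Or.inr (Or.inr (Or.inr (eq_neg_of_add_eq_zero_left h)))

theorem exists_coe_of_mem_U4 {α : ℂ} (h : α ∈ U4) :
    ∃ n : GaussianInt, n.norm = 1 ∧ (n : ℂ) = α := by
  rcases eq_of_mem_U4 h with rfl | rfl | rfl | rfl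
  · exact ⟨1, by decide, by simp⟩
  · exact ⟨-1, by decide, by simp⟩
  · exact ⟨⟨0, 1⟩, by decide, by simp [GaussianInt.toComplex_def]⟩
  · exact ⟨⟨0, -1⟩, by decide, by simp [GaussianInt.toComplex_def]⟩

/-! ### The unit box -/

/-- The conditions on `w ∈ W₁` that are used below. -/
structure Reduced1 (w : ℂ × ℂ) : Prop where
  norm_fst : ‖w.1‖ < 1
  norm_snd : ‖w.2‖ < 1
  fst_ne : w.1 ≠ 0
  box : ∀ n : GaussianInt, n ≠ 0 → n.norm ≤ 3 →
    1 < ‖(n : ℂ) • baseU w + baseV w‖ ∧ 1 < ‖baseU w + (n : ℂ) • baseV w‖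

/-- The conditions on `w ∈ W₂` that are used below. -/
structure Reduced2 (w : ℂ × ℂ) : Prop where
  norm_fst : ‖w.1‖ < 1
  norm_snd : ‖w.2‖ < 1
  fst_ne : w.1 ≠ 0
  box : ∀ n : GaussianInt, n.norm = 1 → √2 < ‖(n : ℂ) • baseU w + baseV w‖
  -- Lets (−U + mV)/(1 + i) replace −U + gV, with g divisible by 1 + i, in the search for the next
  -- minimal vector.
  next : ∀ g : GaussianInt, onePlusI ∣ g → ‖1 - g * w.1‖ < ‖w.1‖ →
    ∃ m : GaussianInt, m.norm = 1 ∧ ‖1 - m * w.1‖ < √2 * ‖w.1‖ ∧ ‖m - w.2‖ ≤ √2 * ‖g - w.2‖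

/-- The conditions on `w ∈ W_k` that are used below. -/
def Reduced (k : ℕ) (w : ℂ × ℂ) : Prop := (k = 1 ∧ Reduced1 w) ∨ (k = 2 ∧ Reduced2 w)

theorem Reduced.norm_fst {k : ℕ} {w : ℂ × ℂ} (h : Reduced k w) : ‖w.1‖ < 1 :=
  h.elim (fun h => h.2.norm_fst) (fun h => h.2.norm_fst)

theorem Reduced.norm_snd {k : ℕ} {w : ℂ × ℂ} (h : Reduced k w) : ‖w.2‖ < 1 :=
  h.elim (fun h => h.2.norm_snd) (fun h => h.2.norm_snd)

theorem Reduced.fst_ne {k : ℕ} {w : ℂ × ℂ} (h : Reduced k w) : w.1 ≠ 0 :=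
  h.elim (fun h => h.2.fst_ne) (fun h => h.2.fst_ne)

theorem norm_baseU {w : ℂ × ℂ} (h2 : ‖w.2‖ < 1) : ‖baseU w‖ = 1 := by
  simp [baseU, Prod.norm_def, h2.le]

theorem norm_baseV {w : ℂ × ℂ} (h1 : ‖w.1‖ < 1) : ‖baseV w‖ = 1 := by
  simp [baseV, Prod.norm_def, h1.le]

theorem sub_lt_norm_lincomb {w : ℂ × ℂ} (h2 : ‖w.2‖ < 1) (c d : ℂ) (hc : c ≠ 0) :
    ‖d‖ - ‖c‖ < ‖c • baseU w + d • baseV w‖ := by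
  refine lt_of_lt_of_le ?_ (norm_snd_le _)
  have := norm_sub_norm_le d (-(c * w.2))
  simp only [sub_neg_eq_add, norm_neg, norm_mul] at this
  simp only [baseU, baseV, Prod.snd_add, Prod.smul_snd, smul_eq_mul, mul_one]
  rw [add_comm]
  have hc' : 0 < ‖c‖ := norm_pos_iff.2 hc
  nlinarith

theorem sub_lt_norm_lincomb' {w : ℂ × ℂ} (h1 : ‖w.1‖ < 1) (c d : ℂ) (hd : d ≠ 0) :
    ‖c‖ - ‖d‖ < ‖c • baseU w + d • baseV w‖ := by
  refine lt_of_lt_of_le ?_ (norm_fst_le _)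
  have := norm_sub_norm_le c (-(d * w.1))
  simp only [sub_neg_eq_add, norm_neg, norm_mul] at this
  simp only [baseU, baseV, Prod.fst_add, Prod.smul_fst, smul_eq_mul, mul_one]
  have hd' : 0 < ‖d‖ := norm_pos_iff.2 hd
  nlinarith

theorem eq_unit_smul_of_integral {w : ℂ × ℂ} (h1 : ‖w.1‖ < 1) (h2 : ‖w.2‖ < 1)
    (h : ∀ n : GaussianInt, n ≠ 0 → n.norm ≤ 3 →
      1 < ‖(n : ℂ) • baseU w + baseV w‖ ∧ 1 < ‖baseU w + (n : ℂ) • baseV w‖)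
    {z : ℂ × ℂ} (hz : z ∈ latticeSpan (baseU w) (baseV w)) (hz0 : z ≠ 0) (hz1 : ‖z‖ ≤ 1) :
    ∃ α ∈ U4, z = α • baseU w ∨ z = α • baseV w := by
  obtain ⟨p, q, rfl⟩ := hz
  have unit : ∀ n : GaussianInt, n ≠ 0 → ‖(n : ℂ)‖ ≤ 1 → (n : ℂ) ∈ U4 := by
    intro n hn hn1
    apply coe_mem_U4
    have a1 := GaussianInt.norm_pos.2 hn
    have a2 : n.norm ≤ 1 := by
      have : (n.norm : ℝ) ≤ 1 := by rw [← norm_coe_sq]; nlinarith [norm_nonneg (n : ℂ)]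
      exact_mod_cast this
    omega
  rcases eq_or_ne p 0 with rfl | hp
  · simp only [map_zero, zero_smul, zero_add] at *
    rw [norm_smul, norm_baseV h1, mul_one] at hz1
    exact ⟨q, unit q (by rintro rfl; simp at hz0) hz1, Or.inr rfl⟩
  rcases eq_or_ne q 0 with rfl | hq
  · simp only [map_zero, zero_smul, add_zero] at *
    rw [norm_smul, norm_baseU h2, mul_one] at hz1
    exact ⟨p, unit p hp hz1, Or.inl rfl⟩
  exact absurd hz1 (not_le.2 (one_lt_norm_of_reduced (norm_baseU h2).le (norm_baseV h1).le
    (sub_lt_norm_lincomb h2) (sub_lt_norm_lincomb' h1) h hp hq))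

theorem one_add_I_smul_baseB (w : ℂ × ℂ) :
    (1 + Complex.I) • baseB 2 w = baseU w + baseV w := by
  rw [baseB, if_pos rfl, smul_smul, mul_one_div_cancel one_add_I_ne_zero, one_smul]

/-- For k = 2, either z lies in the span of U and V, or (1 + i)z = pU + (p + (1 + i)q)V has two odd
coefficients; its norm then exceeds √2. -/
theorem Reduced.eq_unit_smul {k : ℕ} {w : ℂ × ℂ} (hw : Reduced k w) {z : ℂ × ℂ}
    (hz : z ∈ normLattice k w) (hz0 : z ≠ 0) (hz1 : ‖z‖ ≤ 1) :
    ∃ α ∈ U4, z = α • baseU w ∨ z = α • baseV w := by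
  have h1 := hw.norm_fst
  have h2 := hw.norm_snd
  rcases hw with ⟨rfl, hw⟩ | ⟨rfl, hw⟩
  · exact eq_unit_smul_of_integral h1 h2 hw.box (by simpa [normLattice, baseB] using hz) hz0 hz1
  · obtain ⟨p, q, rfl⟩ := hz
    by_cases hp : onePlusI ∣ p
    · obtain ⟨p, rfl⟩ := hp
      refine eq_unit_smul_of_integral h1 h2 (fun n hn0 hn3 => ⟨?_, ?_⟩) ?_ hz0 hz1
      · exact one_lt_norm_of_unit_combinations (norm_baseV h1).le hw.box hn0 hn3
      · rw [add_comm]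
        refine one_lt_norm_of_unit_combinations (norm_baseU h2).le (fun m hm => ?_) hn0 hn3
        have h := norm_lincomb_of_unit (u := baseU w) (v := baseV w) hm 1
        rw [map_one, one_smul, add_comm] at h
        rw [h]
        exact hw.box _ (by rw [norm_star_mul hm]; rfl)
      · refine ⟨p, p + q, ?_⟩
        rw [map_mul, mul_comm, mul_smul, onePlusI_coe, one_add_I_smul_baseB, map_add]
        module
    · exfalso
      have hz : (1 + Complex.I) • ((p : ℂ) • baseB 2 w + (q : ℂ) • baseV w) =
          (p : ℂ) • baseU w + ((p + onePlusI * q : GaussianInt) : ℂ) • baseV w := by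
        rw [smul_add, smul_comm, one_add_I_smul_baseB, map_add, map_mul, onePlusI_coe]
        module
      have := sqrt_two_lt_norm_of_odd (norm_baseU h2).le (norm_baseV h1).le hw.box hp
        (q := p + onePlusI * q) (by simpa [dvd_add_left] using hp)
      rw [← hz, norm_smul, norm_one_add_I] at this
      nlinarith [Real.sqrt_nonneg 2]

/-! ### The next minimal vector -/

/-- Write x = pb + qv with p, q coprime. If N(p) ≥ 4 and r = q − np is a short remainder, then X =
−b − nv satisfies pX = rv − x, and 1 + |r| ≤ |p| keeps both bounds; `hbox` supplies |v₂| < |x₂| for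
the second one. If N(p) is 1 or 2, a unit factor brings p to −1 or −(1 + i). -/
theorem exists_next_le {b v y : ℂ × ℂ} (hbox : ∀ z ∈ latticeSpan b v, z ≠ 0 → ‖z.1‖ < ‖v.1‖ →
    ‖v.2‖ < ‖z.2‖) (hy : y ∈ latticeSpan b v) (hy0 : y ≠ 0) (hy1 : ‖y.1‖ < ‖v.1‖) :
    ∃ a g : GaussianInt, (a = 1 ∨ a = onePlusI ∧ ¬ onePlusI ∣ g) ∧
      ‖((-a : ℂ) • b + (g : ℂ) • v).1‖ < ‖v.1‖ ∧
      ‖((-a : ℂ) • b + (g : ℂ) • v).2‖ ≤ ‖y.2‖ := by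
  obtain ⟨p, q, rfl⟩ := hy
  have hp : p ≠ 0 := by
    rintro rfl
    simp only [map_zero, zero_smul, zero_add] at hy0 hy1
    have hq : q ≠ 0 := by rintro rfl; simp at hy0
    rw [Prod.smul_fst, norm_smul] at hy1
    nlinarith [one_le_norm_coe hq, norm_nonneg v.1]
  obtain ⟨d, p, q, hd, rfl, rfl, hc⟩ := exists_isCoprime (q := q) hp
  have hyd : ((d * p : GaussianInt) : ℂ) • b + ((d * q : GaussianInt) : ℂ) • v =
      (d : ℂ) • ((p : ℂ) • b + (q : ℂ) • v) := by
    rw [map_mul, map_mul]; module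
  rw [hyd] at hy0 hy1 ⊢
  have hx0 : (p : ℂ) • b + (q : ℂ) • v ≠ 0 := by
    intro h; rw [h, smul_zero] at hy0; exact hy0 rfl
  have hxm := lincomb_mem_latticeSpan p q b v
  rw [Prod.smul_fst, norm_smul] at hy1
  rw [Prod.smul_snd, norm_smul]
  set x := (p : ℂ) • b + (q : ℂ) • v with hx
  have hd1 := one_le_norm_coe hd
  have hx1 : ‖x.1‖ < ‖v.1‖ := by nlinarith [norm_nonneg x.1]
  have hx2 : ‖v.2‖ < ‖x.2‖ := hbox x hxm hx0 hx1
  have hle : ‖x.2‖ ≤ ‖(d : ℂ)‖ * ‖x.2‖ := by nlinarith [norm_nonneg x.2]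
  have hp' : p ≠ 0 := right_ne_zero_of_mul hp
  rcases le_or_gt 4 p.norm with h4 | h4
  · obtain ⟨n, hn⟩ := exists_short_remainder hc h4
    have hpn : (2 : ℝ) ≤ ‖(p : ℂ)‖ := le_norm_coe (by
      rw [show (2 : ℝ) ^ 2 = ((4 : ℤ) : ℝ) by norm_num]; exact_mod_cast h4)
    have hpX : (p : ℂ) • ((-(1 : GaussianInt) : ℂ) • b + ((-n : GaussianInt) : ℂ) • v) =
        ((q - n * p : GaussianInt) : ℂ) • v - x := by
      rw [hx]; simp only [map_sub, map_mul, map_one, map_neg]; module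
    set X := (-(1 : GaussianInt) : ℂ) • b + ((-n : GaussianInt) : ℂ) • v
    set r := q - n * p
    refine ⟨1, -n, Or.inl rfl, ?_, le_trans ?_ hle⟩
    · have e := congrArg Prod.fst hpX
      rw [Prod.smul_fst, Prod.fst_sub, Prod.smul_fst] at e
      have e1 : ‖(p : ℂ)‖ * ‖X.1‖ ≤ ‖(r : ℂ)‖ * ‖v.1‖ + ‖x.1‖ := by
        rw [← norm_smul, e, ← norm_smul]; exact norm_sub_le _ _
      by_contra! hcon
      nlinarith [norm_nonneg (r : ℂ), norm_nonneg v.1]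
    · have e := congrArg Prod.snd hpX
      rw [Prod.smul_snd, Prod.snd_sub, Prod.smul_snd] at e
      have e1 : ‖(p : ℂ)‖ * ‖X.2‖ ≤ ‖(r : ℂ)‖ * ‖v.2‖ + ‖x.2‖ := by
        rw [← norm_smul, e, ← norm_smul]; exact norm_sub_le _ _
      by_contra! hcon
      nlinarith [norm_nonneg (r : ℂ), norm_nonneg v.2]
  · have final : ∀ e a g : GaussianInt, e.norm = 1 →
        (-a : ℂ) • b + (g : ℂ) • v = (e : ℂ) • x →
        ‖((-a : ℂ) • b + (g : ℂ) • v).1‖ < ‖v.1‖ ∧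
        ‖((-a : ℂ) • b + (g : ℂ) • v).2‖ ≤ ‖(d : ℂ)‖ * ‖x.2‖ := by
      intro e a g he h
      rw [h, Prod.smul_fst, Prod.smul_snd, norm_smul, norm_smul, norm_coe_of_norm_eq_one he,
        one_mul, one_mul]
      exact ⟨hx1, hle⟩
    rcases norm_eq_one_or_dvd (x := p) (by omega) with hp1 | ⟨e, rfl⟩
    · refine ⟨1, -star p * q, Or.inl rfl, final (-star p) 1 _ ?_ ?_⟩
      · rw [Zsqrtd.norm_neg, Zsqrtd.norm_conj, hp1]
      · have h : (star p : GaussianInt) * (p : ℂ) = 1 := by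
          rw [← map_mul, mul_comm, mul_star_of_norm_eq_one hp1, map_one]
        have h' : ((-star p : GaussianInt) : ℂ) * p = -(1 : GaussianInt) := by
          rw [map_neg, map_one]; linear_combination -h
        rw [hx, smul_add, smul_smul, h', smul_smul, map_mul]
    · have he : e.norm = 1 := by
        have := GaussianInt.norm_pos.2 (right_ne_zero_of_mul hp')
        rw [Zsqrtd.norm_mul, norm_onePlusI] at h4
        omega
      refine ⟨onePlusI, -star e * q, Or.inr ⟨rfl, ?_⟩, final (-star e) onePlusI _ ?_ ?_⟩
      · rintro ⟨y, hy⟩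
        have hq : onePlusI ∣ q := ⟨-e * y, by
          linear_combination -e * hy - q * mul_star_of_norm_eq_one he⟩
        exact not_isUnit_of_one_lt_norm (by rw [norm_onePlusI]; norm_num)
          (hc.isUnit_of_dvd' (dvd_mul_right _ _) hq)
      · rw [Zsqrtd.norm_neg, Zsqrtd.norm_conj, he]
      · have h : (star e : GaussianInt) * (e : ℂ) = 1 := by
          rw [← map_mul, mul_comm, mul_star_of_norm_eq_one he, map_one]
        have h' : ((-star e : GaussianInt) : ℂ) * ((onePlusI * e : GaussianInt) : ℂ) =
            -onePlusI := by
          rw [map_mul, map_neg]; linear_combination -(onePlusI : ℂ) * h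
        rw [hx, smul_add, smul_smul, h', smul_smul, map_mul]

/-! ### The parameter sets give reduced pairs -/

theorem norm_le_iff_sq {z : ℂ} {c : ℝ} (hc : 0 ≤ c) : ‖z‖ ≤ c ↔ z.re ^ 2 + z.im ^ 2 ≤ c ^ 2 := by
  rw [← sq_le_sq₀ (norm_nonneg z) hc, ← Complex.normSq_eq_norm_sq, Complex.normSq_apply, sq z.re, sq z.im]

theorem lt_norm_iff_sq {z : ℂ} {c : ℝ} (hc : 0 ≤ c) : c < ‖z‖ ↔ c ^ 2 < z.re ^ 2 + z.im ^ 2 := by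
  rw [← not_le, norm_le_iff_sq hc, not_le]

theorem lt_norm_prod_iff {z : ℂ × ℂ} {c : ℝ} (hc : 0 ≤ c) :
    c < ‖z‖ ↔ c ^ 2 < z.1.re ^ 2 + z.1.im ^ 2 ∨ c ^ 2 < z.2.re ^ 2 + z.2.im ^ 2 := by
  rw [Prod.norm_def, lt_max_iff, lt_norm_iff_sq hc, lt_norm_iff_sq hc]

theorem im_le_re_of_mem_setC {z : ℂ} (hz : z ∈ setC) : 0 ≤ z.im ∧ z.im ≤ z.re := by
  obtain ⟨-, h0, h1⟩ := hz
  refine ⟨Complex.arg_nonneg_iff.1 h0, ?_⟩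
  rw [← Complex.norm_mul_cos_arg z, ← Complex.norm_mul_sin_arg z]
  refine mul_le_mul_of_nonneg_left ?_ (norm_nonneg z)
  rw [← Real.cos_pi_div_two_sub]
  exact Real.cos_le_cos_of_nonneg_of_le_pi h0 (by linarith [Real.pi_pos]) (by linarith)

/-- For most of the eight n of norm 1 or 2 the sector 𝒞 or the set 𝒟 is enough. For n = ±i and n =
−1 − i some inequalities say instead that w₁ and w₂ do not lie simultaneously in two given disks. -/
theorem reduced1_of_mem_W10 {w : ℂ × ℂ} (hw : w ∈ W10) : Reduced1 w := by
  obtain ⟨hC, hD, hcase⟩ := hw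
  obtain ⟨hb0, hba⟩ := im_le_re_of_mem_setC hC
  have hC1 := hC.1
  obtain ⟨hD1, hD2, hD3⟩ := hD
  have h12 : (1 / √2) ^ 2 = (1 / 2 : ℝ) := by rw [div_pow, Real.sq_sqrt] <;> norm_num
  have hre : ((1 - Complex.I) / 2).re = 1 / 2 := by norm_num
  have him : ((1 - Complex.I) / 2).im = -1 / 2 := by norm_num
  have hpos : 0 ≤ 1 / √2 := by positivity
  have hn1 := hC1
  have hn2 := hD1
  rw [dist_eq_norm, lt_norm_iff_sq zero_le_one] at hD2 hD3
  rw [← not_le, ← one_div_one, ← not_lt] at hC1 hD1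
  simp only [red1, red2, green1, green2, blue1, blue2, Set.mem_union, Set.mem_sdiff,
    Metric.mem_closedBall, dist_eq_norm, norm_le_iff_sq zero_le_one, norm_le_iff_sq hpos, h12,
    Complex.sub_re, Complex.sub_im, hre, him, Complex.neg_re, Complex.neg_im, Complex.add_re,
    Complex.add_im, Complex.one_re, Complex.one_im, Complex.I_re, Complex.I_im] at hcase hD2 hD3
  have hC2 : w.1.re ^ 2 + w.1.im ^ 2 < 1 := by
    have := Complex.normSq_eq_norm_sq w.1
    rw [Complex.normSq_apply] at this
    nlinarith [norm_nonneg w.1]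
  have hD4 : w.2.re ^ 2 + w.2.im ^ 2 < 1 := by
    have := Complex.normSq_eq_norm_sq w.2
    rw [Complex.normSq_apply] at this
    nlinarith [norm_nonneg w.2]
  have hfst : w.1 ≠ 0 := by
    intro h0
    simp only [h0, Complex.zero_re, Complex.zero_im] at hcase
    rcases hcase with ⟨-, h⟩ | ⟨-, h⟩ | ⟨-, h⟩ | ⟨-, h⟩
    · exact h (Or.inl (by norm_num))
    · exact h (by norm_num)
    · exact h rfl
    · exact h (by norm_num)
  have ha : 0 < w.1.re := by
    rcases (hb0.trans hba).lt_or_eq with h | h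
    · exact h
    · exact absurd (Complex.ext (by simp [← h]) (by simp; linarith)) hfst
  refine ⟨hn1, hn2, hfst, ?_⟩
  clear hC hn1 hn2 hfst hC1 hD1
  -- Within 𝒟, the disk E lies in A' and A' misses B. Hence each alternative of `W10` excludes the
  -- three products A × A', B × E and E × B.
  have hEA : (w.2.re - 1 / 2) ^ 2 + (w.2.im + 1 / 2) ^ 2 ≤ 1 / 2 →
      w.2.re ^ 2 + (w.2.im + 1) ^ 2 ≤ 1 := fun h => by nlinarith
  have hAB : w.2.re ^ 2 + (w.2.im + 1) ^ 2 ≤ 1 →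
      1 < (w.2.re - 1) ^ 2 + (w.2.im - 1) ^ 2 := fun h => by nlinarith
  have FA : 1 < w.1.re ^ 2 + (w.1.im - 1) ^ 2 ∨ 1 < w.2.re ^ 2 + (w.2.im + 1) ^ 2 := by
    by_contra! hcon
    rcases hcase with ⟨h, h'⟩ | ⟨h, h'⟩ | ⟨h, h'⟩ | ⟨h, h'⟩
    · exact h' (Or.inl (by linarith))
    · exact h' (by linarith)
    · exact h (Or.inl (by linarith))
    · linarith [hAB hcon.2]
  have FG : 1 < (w.1.re - 1) ^ 2 + (w.1.im - 1) ^ 2 ∨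
      1 / 2 < (w.2.re - 1 / 2) ^ 2 + (w.2.im + 1 / 2) ^ 2 := by
    by_contra! hcon
    rcases hcase with ⟨h, h'⟩ | ⟨h, h'⟩ | ⟨h, h'⟩ | ⟨h, h'⟩
    · exact h' (Or.inr (by linarith))
    · exact h.2 (by linarith)
    · exact h (Or.inl (by linarith [hEA hcon.2]))
    · linarith [hAB (hEA hcon.2)]
  have FB : 1 / 2 < (w.1.re - 1 / 2) ^ 2 + (w.1.im + 1 / 2) ^ 2 ∨
      1 < (w.2.re - 1) ^ 2 + (w.2.im - 1) ^ 2 := by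
    by_contra! hcon
    rcases hcase with ⟨h, h'⟩ | ⟨h, h'⟩ | ⟨h, h'⟩ | ⟨h, h'⟩
    · linarith [hAB (hEA (by linarith))]
    · linarith [hAB (by linarith)]
    · exact h (Or.inr (by linarith))
    · exact h' (by linarith)
  clear hcase hEA hAB h12 hre him hpos
  intro n hn0 hn3
  rw [lt_norm_prod_iff zero_le_one, lt_norm_prod_iff zero_le_one]
  rw [norm_eq_re_im] at hn3
  obtain ⟨s, t⟩ := n
  simp only at hn3
  have h1 : -1 ≤ s := by nlinarith [sq_nonneg t]
  have h2 : s ≤ 1 := by nlinarith [sq_nonneg t]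
  have h3 : -1 ≤ t := by nlinarith [sq_nonneg s]
  have h4 : t ≤ 1 := by nlinarith [sq_nonneg s]
  have hst : ¬ (s = 0 ∧ t = 0) := by rintro ⟨rfl, rfl⟩; exact hn0 rfl
  simp only [baseU, baseV, Prod.fst_add, Prod.snd_add, Prod.smul_fst, Prod.smul_snd, smul_eq_mul,
    Complex.add_re, Complex.add_im, Complex.mul_re, Complex.mul_im, Complex.one_re,
    Complex.one_im, GaussianInt.re_toComplex, GaussianInt.im_toComplex]
  clear hn0 hn3
  interval_cases s <;> interval_cases t <;> first | exact absurd ⟨rfl, rfl⟩ hst | skip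
  all_goals push_cast
  all_goals simp only [mul_one, mul_zero, zero_mul, one_mul, sub_zero, add_zero, zero_add, zero_sub]
  · exact ⟨FG.imp (fun h => by linarith) (fun h => by linarith),
      FB.imp (fun h => by linarith) (fun h => by linarith)⟩
  · exact ⟨Or.inr (by linarith), Or.inr (by linarith)⟩
  · exact ⟨Or.inl (by nlinarith), Or.inr (by linarith)⟩
  · exact ⟨FA.imp (fun h => by linarith) (fun h => by linarith), Or.inl (by nlinarith)⟩
  · exact ⟨Or.inl (by nlinarith), FA.imp (fun h => by linarith) (fun h => by linarith)⟩
  · exact ⟨Or.inl (by nlinarith), Or.inl (by nlinarith)⟩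
  · exact ⟨Or.inl (by nlinarith), Or.inl (by nlinarith)⟩
  · exact ⟨Or.inl (by nlinarith), Or.inl (by nlinarith)⟩

/-- With w₁ = a + bi, the Gaussian integer g = p + qi is at distance less than 1 from 1/w₁, a point
of the closed fourth quadrant; and g ≠ 0 because |w₁| < 1. -/
theorem quadrant_of_near {a b : ℝ} {p q : ℤ} (ha : 0 ≤ a) (hb : 0 ≤ b) (h0 : 0 < a ^ 2 + b ^ 2)
    (h1 : a ^ 2 + b ^ 2 < 1) (h : (1 - (p * a - q * b)) ^ 2 + (p * b + q * a) ^ 2 < a ^ 2 + b ^ 2) :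
    0 ≤ p ∧ q ≤ 0 ∧ p - q ≠ 0 := by
  -- This is |w̄₁ − ρg| < ρ with ρ = |w₁|².
  have h3 : (a - p * (a ^ 2 + b ^ 2)) ^ 2 + (b + q * (a ^ 2 + b ^ 2)) ^ 2 <
      (a ^ 2 + b ^ 2) ^ 2 := by
    linarith [mul_lt_mul_of_pos_left h h0]
  have h4 : ¬ (p = 0 ∧ q = 0) := by
    rintro ⟨rfl, rfl⟩
    norm_num at h
    linarith
  generalize a ^ 2 + b ^ 2 = ρ at h3 h0
  have hp : 0 ≤ p := by
    by_contra! hcon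
    have h5 : (p : ℝ) ≤ -1 := by exact_mod_cast (by omega : p ≤ -1)
    have h6 : ρ ≤ a - p * ρ := by linarith [mul_le_mul_of_nonneg_right h5 h0.le]
    linarith [sq_nonneg (b + q * ρ), pow_le_pow_left₀ h0.le h6 2]
  have hq : q ≤ 0 := by
    by_contra! hcon
    have h5 : (1 : ℝ) ≤ q := by exact_mod_cast hcon
    have h6 : ρ ≤ b + q * ρ := by linarith [mul_le_mul_of_nonneg_right h5 h0.le]
    linarith [sq_nonneg (a - p * ρ), pow_le_pow_left₀ h0.le h6 2]
  exact ⟨hp, hq, by omega⟩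

theorem reduced2_of_mem_W20 {w : ℂ × ℂ} (hw : w ∈ W20) : Reduced2 w := by
  obtain ⟨⟨hC, hC2⟩, hT1, hT2, hT3⟩ := hw
  obtain ⟨hb0, hba⟩ := im_le_re_of_mem_setC hC
  have s2 : √2 ^ 2 = 2 := Real.sq_sqrt (by norm_num)
  have s0 : 0 ≤ √2 := Real.sqrt_nonneg 2
  rw [Metric.mem_closedBall, not_le, dist_eq_norm, lt_norm_iff_sq s0, s2] at hC2
  rw [dist_eq_norm, lt_norm_iff_sq s0, s2] at hT2 hT3
  simp only [Complex.sub_re, Complex.sub_im, Complex.neg_re, Complex.neg_im, Complex.one_re,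
    Complex.one_im, Complex.I_re, Complex.I_im] at hC2 hT2 hT3
  have n1 : w.1.re ^ 2 + w.1.im ^ 2 = ‖w.1‖ ^ 2 := by
    rw [← Complex.normSq_eq_norm_sq, Complex.normSq_apply, sq, sq]
  have n2 : w.2.re ^ 2 + w.2.im ^ 2 = ‖w.2‖ ^ 2 := by
    rw [← Complex.normSq_eq_norm_sq, Complex.normSq_apply, sq, sq]
  have hC1 : w.1.re ^ 2 + w.1.im ^ 2 < 1 := by
    have := hC.1
    nlinarith [norm_nonneg w.1]
  have hT4 : w.2.re ^ 2 + w.2.im ^ 2 < 1 := by nlinarith [norm_nonneg w.2]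
  refine ⟨hC.1, hT1, ?_, ?_, ?_⟩
  · intro h0
    simp only [h0, Complex.zero_re, Complex.zero_im] at hC2
    norm_num at hC2
  · intro n hn
    rw [lt_norm_prod_iff s0, s2]
    rw [norm_eq_re_im] at hn
    obtain ⟨s, t⟩ := n
    simp only at hn
    have h1 : -1 ≤ s := by nlinarith [sq_nonneg t]
    have h2 : s ≤ 1 := by nlinarith [sq_nonneg t]
    have h3 : -1 ≤ t := by nlinarith [sq_nonneg s]
    have h4 : t ≤ 1 := by nlinarith [sq_nonneg s]
    simp only [baseU, baseV, Prod.fst_add, Prod.snd_add, Prod.smul_fst, Prod.smul_snd,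
      smul_eq_mul, Complex.add_re, Complex.add_im, Complex.mul_re, Complex.mul_im,
      Complex.one_re, Complex.one_im, GaussianInt.re_toComplex, GaussianInt.im_toComplex]
    interval_cases s <;> interval_cases t <;> first | omega | skip
    all_goals push_cast
    · right; nlinarith
    · right; nlinarith
    · left; nlinarith
    · left; nlinarith
  · intro g hg hg1
    rw [onePlusI_dvd_iff] at hg
    -- The unit is m = −i: the inequality |1 + iw₁| < √2|w₁| is equivalent to |w₁ + i| > √2.
    refine ⟨⟨0, -1⟩, by decide, ?_, ?_⟩
    · rw [← sq_lt_sq₀ (norm_nonneg _) (by positivity), mul_pow, s2, ← n1,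
        ← Complex.normSq_eq_norm_sq, Complex.normSq_apply]
      simp only [Complex.sub_re, Complex.sub_im, Complex.mul_re, Complex.mul_im, Complex.one_re,
        Complex.one_im, GaussianInt.re_toComplex, GaussianInt.im_toComplex]
      push_cast
      nlinarith
    · have hg2 : ‖1 - g * w.1‖ ^ 2 < ‖w.1‖ ^ 2 := by
        rwa [sq_lt_sq₀ (norm_nonneg _) (norm_nonneg _)]
      rw [← n1, ← Complex.normSq_eq_norm_sq, Complex.normSq_apply] at hg2
      rw [← sq_le_sq₀ (norm_nonneg _) (by positivity), mul_pow, s2,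
        ← Complex.normSq_eq_norm_sq, ← Complex.normSq_eq_norm_sq, Complex.normSq_apply,
        Complex.normSq_apply]
      obtain ⟨p, q⟩ := g
      simp only [Complex.sub_re, Complex.sub_im, Complex.mul_re, Complex.mul_im, Complex.one_re,
        Complex.one_im, GaussianInt.re_toComplex, GaussianInt.im_toComplex] at hg2 hg ⊢
      push_cast
      clear n1 n2 hT1 hg1 hC
      generalize w.1.re = a at *
      generalize w.1.im = b at *
      generalize w.2.re = c at *
      generalize w.2.im = d at *
      have hρ : 0 < a ^ 2 + b ^ 2 := by nlinarith
      obtain ⟨hp, hq, hpq⟩ := quadrant_of_near (p := p) (q := q) (hb0.trans hba) hb0 hρ hC1 (by linarith)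
      have hpq2 : (2 : ℝ) ≤ p - q := by exact_mod_cast (by omega : 2 ≤ p - q)
      have hp' : (0 : ℝ) ≤ p := by exact_mod_cast hp
      have hq' : (q : ℝ) ≤ 0 := by exact_mod_cast hq
      -- The conditions of 𝒯 put w₂ in the open second quadrant, opposite to g. Since N(g) ≥ 2, this
      -- gives 2|g − w₂|² ≥ 4 + 2|w₂|² ≥ |−i − w₂|².
      have hc : c < 0 := by linarith
      have hd : 0 < d := by linarith
      have hpc := mul_nonneg hp' (neg_nonneg.2 hc.le)
      have hqd := mul_nonneg (neg_nonneg.2 hq') hd.le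
      have e1 : 2 ≤ (p : ℝ) ^ 2 + q ^ 2 := by
        linarith [sq_nonneg ((p : ℝ) + q), pow_le_pow_left₀ zero_le_two hpq2 2]
      have e2 : d ≤ 1 := by linarith [sq_nonneg (d - 1), sq_nonneg c]
      linarith [sq_nonneg c, sq_nonneg d]

/-! ### Symmetries -/

theorem norm_unit_mul {e : GaussianInt} (he : e.norm = 1) (z : ℂ) : ‖(e : ℂ) * z‖ = ‖z‖ := by
  rw [norm_mul, norm_coe_of_norm_eq_one he, one_mul]

theorem unit_mul_star {e : GaussianInt} (he : e.norm = 1) : (e : ℂ) * (star e : GaussianInt) = 1 := by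
  rw [← map_mul, mul_star_of_norm_eq_one he, map_one]

theorem norm_lincomb_rotate {e : GaussianInt} (he : e.norm = 1) (w : ℂ × ℂ) (n : GaussianInt) :
    ‖(n : ℂ) • baseU ((e : ℂ) * w.1, ((star e : GaussianInt) : ℂ) * w.2) +
        baseV ((e : ℂ) * w.1, ((star e : GaussianInt) : ℂ) * w.2)‖ =
      ‖((star e * n : GaussianInt) : ℂ) • baseU w + baseV w‖ := by
  have h := unit_mul_star he
  simp only [Prod.norm_def, baseU, baseV, Prod.fst_add, Prod.snd_add, Prod.smul_fst,
    Prod.smul_snd, smul_eq_mul, map_mul, mul_one]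
  congr 1
  · rw [← norm_unit_mul he (_ + w.1)]; congr 1; linear_combination -(n : ℂ) * h
  · congr 1; ring

theorem norm_lincomb_rotate' {e : GaussianInt} (he : e.norm = 1) (w : ℂ × ℂ) (n : GaussianInt) :
    ‖baseU ((e : ℂ) * w.1, ((star e : GaussianInt) : ℂ) * w.2) +
        (n : ℂ) • baseV ((e : ℂ) * w.1, ((star e : GaussianInt) : ℂ) * w.2)‖ =
      ‖baseU w + ((e * n : GaussianInt) : ℂ) • baseV w‖ := by
  have h := unit_mul_star he
  simp only [Prod.norm_def, baseU, baseV, Prod.fst_add, Prod.snd_add, Prod.smul_fst,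
    Prod.smul_snd, smul_eq_mul, map_mul, mul_one]
  congr 1
  · congr 1; ring
  · rw [← norm_unit_mul he]; congr 1; linear_combination w.2 * h

theorem Reduced1.rotate {w : ℂ × ℂ} (hw : Reduced1 w) {e : GaussianInt}
    (he : e.norm = 1) :
    Reduced1 ((e : ℂ) * w.1, ((star e : GaussianInt) : ℂ) * w.2) := by
  have he' : (star e).norm = 1 := by rw [Zsqrtd.norm_conj, he]
  refine ⟨?_, ?_, ?_, fun n hn0 hn3 => ⟨?_, ?_⟩⟩
  · rw [norm_unit_mul he]; exact hw.norm_fst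
  · rw [norm_unit_mul he']; exact hw.norm_snd
  · rw [← norm_ne_zero_iff, norm_unit_mul he, norm_ne_zero_iff]; exact hw.fst_ne
  · rw [norm_lincomb_rotate he]
    refine (hw.box _ ?_ ?_).1
    · rw [← GaussianInt.norm_pos, norm_star_mul he, GaussianInt.norm_pos]; exact hn0
    · rwa [norm_star_mul he]
  · rw [norm_lincomb_rotate' he]
    refine (hw.box _ ?_ ?_).2
    · rw [← GaussianInt.norm_pos, Zsqrtd.norm_mul, he, one_mul, GaussianInt.norm_pos]; exact hn0
    · rwa [Zsqrtd.norm_mul, he, one_mul]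

theorem Reduced2.rotate {w : ℂ × ℂ} (hw : Reduced2 w) {e : GaussianInt}
    (he : e.norm = 1) :
    Reduced2 ((e : ℂ) * w.1, ((star e : GaussianInt) : ℂ) * w.2) := by
  have he' : (star e).norm = 1 := by rw [Zsqrtd.norm_conj, he]
  have h := unit_mul_star he
  refine ⟨?_, ?_, ?_, fun n hn => ?_, fun g hg hg1 => ?_⟩
  · rw [norm_unit_mul he]; exact hw.norm_fst
  · rw [norm_unit_mul he']; exact hw.norm_snd
  · rw [← norm_ne_zero_iff, norm_unit_mul he, norm_ne_zero_iff]; exact hw.fst_ne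
  · rw [norm_lincomb_rotate he]
    exact hw.box _ (by rw [norm_star_mul he, hn])
  · simp only [norm_unit_mul he] at hg1 ⊢
    obtain ⟨m, hm1, hm2, hm3⟩ := hw.next (g * e) (hg.mul_right e)
      (by rwa [map_mul, mul_assoc])
    refine ⟨m * star e, by rw [Zsqrtd.norm_mul, hm1, he', one_mul], ?_, ?_⟩
    · convert hm2 using 3
      rw [map_mul]; linear_combination (m : ℂ) * w.1 * h
    · convert hm3 using 1
      · rw [← norm_unit_mul he]; congr 1
        rw [map_mul]; linear_combination ((m : ℂ) - w.2) * h
      · rw [← norm_unit_mul he]; congr 2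
        rw [map_mul]; linear_combination - w.2 * h

theorem norm_lincomb_conj (w : ℂ × ℂ) (p q : GaussianInt) :
    ‖(p : ℂ) • baseU (starRingEnd ℂ w.1, starRingEnd ℂ w.2) +
        (q : ℂ) • baseV (starRingEnd ℂ w.1, starRingEnd ℂ w.2)‖ =
      ‖((star p : GaussianInt) : ℂ) • baseU w + ((star q : GaussianInt) : ℂ) • baseV w‖ := by
  simp only [Prod.norm_def, baseU, baseV, Prod.fst_add, Prod.snd_add, Prod.smul_fst,
    Prod.smul_snd, smul_eq_mul, mul_one, GaussianInt.toComplex_star]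
  rw [← Complex.norm_conj ((p : ℂ) + _), ← Complex.norm_conj ((p : ℂ) * _ + _)]
  simp

theorem Reduced1.conj {w : ℂ × ℂ} (hw : Reduced1 w) :
    Reduced1 (starRingEnd ℂ w.1, starRingEnd ℂ w.2) := by
  refine ⟨?_, ?_, ?_, fun n hn0 hn3 => ?_⟩
  · rw [Complex.norm_conj]; exact hw.norm_fst
  · rw [Complex.norm_conj]; exact hw.norm_snd
  · simpa using hw.fst_ne
  · have h := hw.box (star n) (star_ne_zero.2 hn0) (by rwa [Zsqrtd.norm_conj])
    have h1 := norm_lincomb_conj w n 1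
    have h2 := norm_lincomb_conj w 1 n
    simp only [star_one, map_one, one_smul] at h1 h2
    rwa [h1, h2]

theorem Reduced2.conj {w : ℂ × ℂ} (hw : Reduced2 w) :
    Reduced2 (starRingEnd ℂ w.1, starRingEnd ℂ w.2) := by
  refine ⟨?_, ?_, ?_, fun n hn => ?_, fun g hg hg1 => ?_⟩
  · rw [Complex.norm_conj]; exact hw.norm_fst
  · rw [Complex.norm_conj]; exact hw.norm_snd
  · simpa using hw.fst_ne
  · have h := hw.box (star n) (by rwa [Zsqrtd.norm_conj])
    have h1 := norm_lincomb_conj w n 1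
    simp only [star_one, map_one, one_smul] at h1
    rwa [h1]
  · have hc : ∀ (n : GaussianInt) (z : ℂ),
        ‖1 - (n : ℂ) * starRingEnd ℂ z‖ = ‖1 - ((star n : GaussianInt) : ℂ) * z‖ := by
      intro n z
      rw [← Complex.norm_conj, GaussianInt.toComplex_star]; simp
    have hc' : ∀ (n : GaussianInt) (z : ℂ),
        ‖(n : ℂ) - starRingEnd ℂ z‖ = ‖((star n : GaussianInt) : ℂ) - z‖ := by
      intro n z
      rw [← Complex.norm_conj, GaussianInt.toComplex_star]; simp
    simp only [hc, hc', Complex.norm_conj] at hg1 ⊢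
    obtain ⟨m, hm1, hm2, hm3⟩ := hw.next (star g)
      (by rw [onePlusI_dvd_iff] at hg ⊢; simp; omega) hg1
    exact ⟨star m, by rwa [Zsqrtd.norm_conj], by rwa [star_star], by rwa [star_star]⟩

theorem reduced_of_mem_W {k : ℕ} (hk : k = 1 ∨ k = 2) {w : ℂ × ℂ} (hw : w ∈ W k) :
    Reduced k w := by
  obtain ⟨φ, ⟨ω, hω, hφ⟩, x, hx, rfl⟩ := hw
  obtain ⟨e, he, rfl⟩ := exists_coe_of_mem_U4 hω
  have h := unit_mul_star he
  have he0 : (e : ℂ) ≠ 0 := left_ne_zero_of_mul_eq_one h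
  -- With e = φ(1), φ acts on pairs, after a possible conjugation, by (w₁, w₂) ↦ (ew₁, ēw₂).
  have hinv : ∀ z : ℂ, 1 / (e : ℂ) ^ 2 * ((e : ℂ) * z) = ((star e : GaussianInt) : ℂ) * z := by
    intro z
    field_simp
    linear_combination -z * h
  rcases hk with rfl | rfl
  · refine Or.inl ⟨rfl, ?_⟩
    rw [if_neg (by norm_num)] at hx
    have hr := reduced1_of_mem_W10 hx
    rcases hφ with rfl | rfl
    · simp only [mul_one, hinv]; exact hr.rotate he
    · simp only [map_one, mul_one, hinv]; exact hr.conj.rotate he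
  · refine Or.inr ⟨rfl, ?_⟩
    rw [if_pos rfl] at hx
    have hr := reduced2_of_mem_W20 hx
    rcases hφ with rfl | rfl
    · simp only [mul_one, hinv]; exact hr.rotate he
    · simp only [map_one, mul_one, hinv]; exact hr.conj.rotate he

/-! ### Diagonal scalings -/

/-- The image of `L` under `diag (c, d)`. -/
def scale (c d : ℂ) (L : Set (ℂ × ℂ)) : Set (ℂ × ℂ) :=
  (fun z : ℂ × ℂ => (c * z.1, d * z.2)) '' L

theorem flow_eq_scale (t : ℝ) (L : Set (ℂ × ℂ)) :
    flow t L = scale (Real.exp t : ℂ) (Real.exp (-t) : ℂ) L := rfl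

theorem scale_scale (c d c' d' : ℂ) (L : Set (ℂ × ℂ)) :
    scale c d (scale c' d' L) = scale (c * c') (d * d') L := by
  rw [scale, scale, scale, Set.image_image]
  simp only [mul_assoc]

theorem scale_latticeSpan (c d : ℂ) (u v : ℂ × ℂ) :
    scale c d (latticeSpan u v) = latticeSpan (c * u.1, d * u.2) (c * v.1, d * v.2) := by
  ext z
  constructor
  · rintro ⟨_, ⟨g, h, rfl⟩, rfl⟩
    refine ⟨g, h, Prod.ext ?_ ?_⟩ <;> simp <;> ring
  · rintro ⟨g, h, rfl⟩
    refine ⟨_, ⟨g, h, rfl⟩, Prod.ext ?_ ?_⟩ <;> simp <;> ring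

theorem flow_mem_Omega1 {L : Set (ℂ × ℂ)} (hL : L ∈ Omega1) (t : ℝ) : flow t L ∈ Omega1 := by
  obtain ⟨u, v, h, rfl⟩ := hL
  refine ⟨_, _, ?_, scale_latticeSpan _ _ u v⟩
  have he : (Real.exp t : ℂ) * (Real.exp (-t) : ℂ) = 1 := by
    rw [← Complex.ofReal_mul, ← Real.exp_add, add_neg_cancel, Real.exp_zero, Complex.ofReal_one]
  convert h using 1
  simp only [det]
  linear_combination (u.1 * v.2 - u.2 * v.1) * he

/-! ### The return time -/

theorem norm_exp_mul (t : ℝ) (z : ℂ) : ‖(Real.exp t : ℂ) * z‖ = Real.exp t * ‖z‖ := by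
  rw [norm_mul, Complex.norm_real, Real.norm_of_nonneg (Real.exp_pos t).le]

theorem exp_two_mul_mul {t x y : ℝ} :
    Real.exp t * x = Real.exp (-t) * y ↔ Real.exp (2 * t) * x = y := by
  have h : Real.exp (2 * t) = Real.exp t * Real.exp t := by rw [← Real.exp_add, two_mul]
  have h1 : Real.exp t * Real.exp (-t) = 1 := by rw [← Real.exp_add, add_neg_cancel, Real.exp_zero]
  rw [← mul_right_inj' (Real.exp_pos t).ne', h]
  constructor <;> intro h2
  · linear_combination h2 + y * h1
  · linear_combination h2 - y * h1

/-- At the time t with e^t|v₁| = e^{−t}|X₂|, `hmin` says that the open box bounded by v and X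
contains only 0. Conversely, a return at time s provides p, q with |q₂| = e^{2s}|p₁|; once |p₁| ≤
|v₁| is known, |q₁| < |v₁| and |X₂| ≤ |q₂| ≤ e^{2s}|v₁|, so s ≥ t. -/
theorem isLeast_returnTimes {L : Set (ℂ × ℂ)} {u v X : ℂ × ℂ} {r : ℝ} (hL : L ∈ Omega1)
    (hvL : v ∈ L) (hXL : X ∈ L) (hv1 : ‖v.1‖ < r) (hu1 : ‖u.1‖ = r)
    (hv2 : ‖v.2‖ = r)
    (hbox : ∀ z ∈ L, z ≠ 0 → ‖z‖ ≤ r → ∃ α ∈ U4, z = α • u ∨ z = α • v)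
    (hv0 : v.1 ≠ 0) (hX1 : ‖X.1‖ < ‖v.1‖) (hX2 : r < ‖X.2‖)
    (hmin : ∀ y ∈ L, y ≠ 0 → ‖y.1‖ < ‖v.1‖ → ‖X.2‖ ≤ ‖y.2‖)
    (huniq : ∀ y ∈ L, ‖y.2‖ = ‖X.2‖ → ‖y.1‖ = ‖X.1‖) :
    IsLeast (returnTimes L) (Real.log (‖X.2‖ / ‖v.1‖) / 2) := by
  have hv0' : 0 < ‖v.1‖ := norm_pos_iff.2 hv0
  have hr : 0 < r := hv0'.trans hv1
  have hq0 : 0 < ‖X.2‖ / ‖v.1‖ := div_pos (hr.trans hX2) hv0'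
  have hL0 : ∀ z : ℂ × ℂ, z.1 ≠ 0 → z ≠ 0 := by rintro z hz rfl; exact hz rfl
  constructor
  · set t := Real.log (‖X.2‖ / ‖v.1‖) / 2 with ht
    have het : Real.exp (2 * t) * ‖v.1‖ = ‖X.2‖ := by
      rw [ht, mul_div_cancel₀ _ two_ne_zero, Real.exp_log hq0, div_mul_cancel₀ _ hv0'.ne']
    have hbal := exp_two_mul_mul.2 het
    have e1 := Real.exp_pos t
    have e2 := Real.exp_pos (-t)
    have img : ∀ z ∈ L, ((Real.exp t : ℂ) * z.1, (Real.exp (-t) : ℂ) * z.2) ∈ flow t L :=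
      fun z hz => ⟨z, hz, rfl⟩
    have img0 : ∀ z : ℂ × ℂ, z = 0 → ((Real.exp t : ℂ) * z.1, (Real.exp (-t) : ℂ) * z.2) = 0 := by
      rintro z rfl; simp
    refine ⟨?_, flow_mem_Omega1 hL t, _, _, ⟨img v hvL, ?_, ?_⟩, ⟨img X hXL, ?_, ?_⟩,
      Real.exp t * ‖v.1‖, ?_, ?_, ?_, ?_, ?_⟩
    · exact half_pos (Real.log_pos ((one_lt_div hv0').2 (hv1.trans hX2)))
    · exact hL0 _ (by simpa using hv0)
    · rintro _ ⟨z, hz, rfl⟩ hz0 h1 h2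
      simp only [norm_exp_mul, mul_le_mul_iff_right₀ e1, mul_le_mul_iff_right₀ e2] at h1 h2 ⊢
      have hz0' : z ≠ 0 := fun h => hz0 (img0 z h)
      obtain ⟨α, hα, rfl | rfl⟩ := hbox z hz hz0'
        (by rw [Prod.norm_def]; exact max_le (h1.trans hv1.le) (h2.trans hv2.le))
      · rw [Prod.smul_fst, norm_smul, norm_of_mem_U4 hα, one_mul, hu1] at h1
        linarith
      · simp [norm_of_mem_U4 hα]
    · intro h
      have h := congrArg Prod.snd h
      have hX20 : X.2 ≠ 0 := norm_pos_iff.1 (hr.trans hX2)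
      simp [hX20] at h
    · rintro _ ⟨z, hz, rfl⟩ hz0 h1 h2
      simp only [norm_exp_mul, mul_le_mul_iff_right₀ e1, mul_le_mul_iff_right₀ e2] at h1 h2 ⊢
      have hz0' : z ≠ 0 := fun h => hz0 (img0 z h)
      have h3 := h2.antisymm (hmin z hz hz0' (h1.trans_lt hX1))
      rw [h3, huniq z hz h3]
      exact ⟨rfl, rfl⟩
    · rw [hbal, norm_exp_mul, mul_lt_mul_iff_right₀ e2, hv2]; exact hX2
    · rw [norm_exp_mul, mul_lt_mul_iff_right₀ e1]; exact hX1
    · rw [norm_exp_mul]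
    · rw [norm_exp_mul, hbal]
    · rintro _ ⟨z, hz, rfl⟩ h
      rw [Prod.norm_def, max_lt_iff] at h
      simp only [norm_exp_mul] at h
      rw [mul_lt_mul_iff_right₀ e1] at h
      rw [hbal, mul_lt_mul_iff_right₀ e2] at h
      by_contra hz0
      exact absurd (hmin z hz (fun h => hz0 (img0 z h)) h.1) (not_le.2 h.2)
  · rintro s ⟨hs, -, _, _, ⟨⟨p, hp, rfl⟩, -, -⟩, ⟨⟨q, hq, rfl⟩, -, -⟩, r', h1, h2, h3, h4, h5⟩
    have e1 := Real.exp_pos s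
    have e2 := Real.exp_pos (-s)
    simp only [norm_exp_mul] at h1 h2 h3 h4
    have hr' : 0 < r' := by
      have := mul_nonneg e2.le (norm_nonneg p.2)
      linarith
    have hpq := exp_two_mul_mul.1 (h3.trans h4.symm)
    have e3 : 1 < Real.exp (2 * s) := Real.one_lt_exp_iff.2 (by linarith)
    have hp0 : 0 < ‖p.1‖ := by
      rw [← h3] at hr'
      exact pos_of_mul_pos_right hr' e1.le
    suffices hs : ‖X.2‖ ≤ Real.exp (2 * s) * ‖v.1‖ by
      have := (div_le_iff₀ hv0').2 hs
      have := (Real.log_le_iff_le_exp hq0).2 this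
      linarith
    -- At time s the vector v is outside the open box, through its first or its second coordinate.
    have hvn := mt (h5 _ ⟨v, hvL, rfl⟩) (hL0 _ (by simpa using hv0))
    rw [Prod.norm_def, max_lt_iff] at hvn
    simp only [norm_exp_mul, not_and_or, not_lt] at hvn
    rcases hvn with hvn | hvn
    · have h6 : ‖p.1‖ ≤ ‖v.1‖ := by
        rw [← h3] at hvn; exact le_of_mul_le_mul_left hvn e1
      have h7 : ‖q.1‖ < ‖v.1‖ := lt_of_mul_lt_mul_left (h2.trans_le hvn) e1.le
      have hq0 : q ≠ 0 := by
        rintro rfl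
        simp at h4
        linarith
      have h8 := hmin q hq hq0 h7
      rw [← hpq] at h8
      exact h8.trans (mul_le_mul_of_nonneg_left h6 (Real.exp_pos _).le)
    -- Here both moduli of p are less than r, whereas every unit multiple of u or v has a modulus
    -- equal to r.
    · exfalso
      have h6 : ‖q.2‖ ≤ r := by
        rw [← h4, hv2] at hvn; exact le_of_mul_le_mul_left hvn e2
      have h7 : ‖p.2‖ < ‖q.2‖ := by
        rw [← h4] at h1; exact lt_of_mul_lt_mul_left h1 e2.le
      have h8 : ‖p.1‖ < r := by nlinarith
      obtain ⟨α, hα, rfl | rfl⟩ := hbox p hp (hL0 p (norm_pos_iff.1 hp0))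
        (by rw [Prod.norm_def]; exact max_le h8.le (h7.le.trans h6))
      · rw [Prod.smul_fst, norm_smul, norm_of_mem_U4 hα, one_mul, hu1] at h8
        linarith
      · rw [Prod.smul_snd, norm_smul, norm_of_mem_U4 hα, one_mul, hv2] at h7
        linarith

/-! ### The choice of the angle -/

theorem exp_arg_of_mem_U4 {α : ℂ} (hα : α ∈ U4) : Complex.exp (Complex.arg α * Complex.I) = α := by
  have := Complex.norm_mul_exp_arg_mul_I α
  rwa [norm_of_mem_U4 hα, Complex.ofReal_one, one_mul] at this

theorem IsAngleChoice.exp_eq {θ θ' : ℝ} {w₁ α : ℂ} (h : IsAngleChoice θ w₁ α θ') :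
    Complex.exp (θ' * Complex.I) =
      Complex.exp ((θ + Complex.arg w₁ : ℝ) * Complex.I) * α := by
  obtain ⟨hα, -, n, hn⟩ := h
  have := Complex.exp_int_mul_two_pi_mul_I (-n)
  rw [← exp_arg_of_mem_U4 hα, ← Complex.exp_add, hn, ← mul_one (Complex.exp _ : ℂ), ← this,
    ← Complex.exp_add]
  congr 1
  push_cast
  ring

/-- Existence: α rotates back by a whole number of quarter turns. Uniqueness: α⁴ = 1, so 4θ' is
determined modulo 2π, hence so is θ' in [0, π/2[, and then α. -/
theorem existsUnique_angleChoice (θ : ℝ) (w₁ : ℂ) :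
    ∃! α : ℂ, ∃ θ' : ℝ, IsAngleChoice θ w₁ α θ' := by
  have hpi := Real.pi_pos
  have hpi2 : 0 < Real.pi / 2 := by positivity
  set x := θ + Complex.arg w₁ with hx
  apply existsUnique_of_exists_of_unique
  · set n := ⌊x / (Real.pi / 2)⌋ with hn
    set α := Complex.exp ((-(n * (Real.pi / 2)) : ℝ) * Complex.I) with hα
    have hα4 : α ∈ U4 := by
      change α ^ 4 = 1
      rw [hα, ← Complex.exp_nat_mul, ← Complex.exp_int_mul_two_pi_mul_I (-n)]
      congr 1
      push_cast
      ring
    refine ⟨α, x - n * (Real.pi / 2), hα4, ⟨?_, ?_⟩, ?_⟩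
    · have := (le_div_iff₀ hpi2).1 (Int.floor_le (x / (Real.pi / 2)))
      rw [← hn] at this
      linarith
    · have := (div_lt_iff₀ hpi2).1 (Int.lt_floor_add_one (x / (Real.pi / 2)))
      rw [← hn] at this
      linarith
    · have h := exp_arg_of_mem_U4 hα4
      obtain ⟨m, hm⟩ := Complex.exp_eq_exp_iff_exists_int.1 (hα.symm.trans h.symm)
      refine ⟨m, ?_⟩
      have h2 : ((-(n * (Real.pi / 2)) : ℝ) : ℂ) =
          ((Complex.arg α + 2 * Real.pi * m : ℝ) : ℂ) := by
        apply mul_right_cancel₀ Complex.I_ne_zero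
        rw [hm]
        push_cast
        ring
      have h3 := Complex.ofReal_injective h2
      linarith
  · rintro α β ⟨θ₁, h₁⟩ ⟨θ₂, h₂⟩
    have e1 := h₁.exp_eq
    have e2 := h₂.exp_eq
    have h4 : Complex.exp ((4 * θ₁ : ℝ) * Complex.I) = Complex.exp ((4 * θ₂ : ℝ) * Complex.I) := by
      have t : ∀ y : ℝ, Complex.exp ((4 * y : ℝ) * Complex.I) =
          Complex.exp (y * Complex.I) ^ 4 := by
        intro y
        rw [← Complex.exp_nat_mul]
        congr 1
        push_cast
        ring
      have hα : α ^ 4 = 1 := h₁.1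
      have hβ : β ^ 4 = 1 := h₂.1
      rw [t, t, e1, e2, mul_pow, mul_pow, hα, hβ]
    obtain ⟨m, hm⟩ := Complex.exp_eq_exp_iff_exists_int.1 h4
    have h5 : ((4 * θ₁ : ℝ) : ℂ) = ((4 * θ₂ + 2 * Real.pi * m : ℝ) : ℂ) := by
      apply mul_right_cancel₀ Complex.I_ne_zero
      rw [hm]
      push_cast
      ring
    have h6 := Complex.ofReal_injective h5
    obtain ⟨l1, l2⟩ := h₁.2.1
    obtain ⟨l3, l4⟩ := h₂.2.1
    have m1 : m < 1 := by
      by_contra! hc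
      have : (1 : ℝ) ≤ m := by exact_mod_cast hc
      nlinarith
    have m2 : -1 < m := by
      by_contra! hc
      have : (m : ℝ) ≤ -1 := by exact_mod_cast hc
      nlinarith
    have m0 : m = 0 := by omega
    subst m0
    have h7 : θ₁ = θ₂ := by push_cast at h6; linarith
    rw [h7, e2] at e1
    exact (mul_left_cancel₀ (Complex.exp_ne_zero _) e1).symm

/-! ### The competing vectors -/

theorem norm_inv_one_add_I : ‖1 / (1 + Complex.I)‖ = 1 / √2 := by
  rw [norm_div, norm_one, norm_one_add_I]

theorem nextVec_fst (k : ℕ) (w : ℂ × ℂ) (p : ℂ × GaussianInt) :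
    (nextVec k w p).1 = if k = 2 then -p.1 * (1 + w.1) + p.2 * w.1 else -p.1 + p.2 * w.1 := by
  unfold nextVec
  split_ifs <;> simp

theorem nextVec_snd (k : ℕ) (w : ℂ × ℂ) (p : ℂ × GaussianInt) :
    (nextVec k w p).2 = if k = 2 then -p.1 * (w.2 + 1) + p.2 else -p.1 * w.2 + p.2 := by
  unfold nextVec
  split_ifs <;> simp

/-- Multiplying by w₁ turns the distance condition into a bound on the first coordinate of the
competing vector. -/
theorem mem_candidates_iff {k : ℕ} {w : ℂ × ℂ} (h0 : w.1 ≠ 0) {p : ℂ × GaussianInt} :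
    p ∈ candidates k w ↔
      (if k = 2 then p.1 = 1 / (1 + Complex.I) else p.1 = 1 ∨ p.1 = 1 + Complex.I) ∧
        ‖(nextVec k w p).1‖ < ‖w.1‖ := by
  have h : ∀ z : ℂ, ‖z‖ < 1 ↔ ‖z * w.1‖ < ‖w.1‖ := by
    intro z
    rw [norm_mul, mul_lt_iff_lt_one_left (norm_pos_iff.2 h0)]
  rw [nextVec_fst]
  unfold candidates
  split_ifs
  · rw [Set.mem_ofPred_eq, h, ← norm_neg]
    have e : -((p.1 / w.1 + p.1 - p.2) * w.1) = -p.1 * (1 + w.1) + p.2 * w.1 := by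
      field_simp; ring
    rw [e]
  · rw [Set.mem_ofPred_eq, h, ← norm_neg]
    have e : -((p.1 / w.1 - p.2) * w.1) = -p.1 + p.2 * w.1 := by
      field_simp; ring
    rw [e]

theorem nextVec_one (w : ℂ × ℂ) (p : ℂ × GaussianInt) :
    nextVec 1 w p = -p.1 • baseB 1 w + (p.2 : ℂ) • baseV w := by
  simp [nextVec, baseB, baseU, baseV]

theorem nextVec_two (w : ℂ × ℂ) (g : GaussianInt) :
    nextVec 2 w (1 / (1 + Complex.I), g) =
      (-(1 : GaussianInt) : ℂ) • baseB 2 w + (g : ℂ) • baseV w := by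
  simp [nextVec, baseB, baseU, baseV, add_comm]

theorem nextVec_mem {k : ℕ} (hk : k = 1 ∨ k = 2) {w : ℂ × ℂ} {p : ℂ × GaussianInt}
    (hp : p ∈ candidates k w) : nextVec k w p ∈ normLattice k w := by
  obtain ⟨a, g⟩ := p
  rcases hk with rfl | rfl
  · rw [nextVec_one]
    rcases hp.1 with h | h <;> simp only at h <;> subst h
    · exact ⟨-1, g, by simp⟩
    · exact ⟨-onePlusI, g, by rw [map_neg, onePlusI_coe]⟩
  · have h : a = 1 / (1 + Complex.I) := hp.1
    rw [h, nextVec_two]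
    exact ⟨-1, g, by simp⟩

theorem det_baseV_nextVec (k : ℕ) (w : ℂ × ℂ) (p : ℂ × GaussianInt) :
    det (baseV w) (nextVec k w p) = p.1 * (1 - w.1 * w.2) := by
  rw [det, nextVec_fst, nextVec_snd]
  split_ifs <;> simp only [baseV] <;> ring

theorem finite_norm_le (R : ℝ) : {g : GaussianInt | ‖(g : ℂ)‖ ≤ R}.Finite := by
  have hinj : Function.Injective (fun g : GaussianInt => (g.re, g.im)) := by
    intro g h hgh
    exact Zsqrtd.ext (congrArg Prod.fst hgh) (congrArg Prod.snd hgh)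
  refine Set.Finite.subset (((Set.finite_Icc (-⌈R⌉) ⌈R⌉).prod
    (Set.finite_Icc (-⌈R⌉) ⌈R⌉)).preimage hinj.injOn) ?_
  intro g hg
  have h1 := abs_le.1 ((Complex.abs_re_le_norm (g : ℂ)).trans hg)
  have h2 := abs_le.1 ((Complex.abs_im_le_norm (g : ℂ)).trans hg)
  rw [← GaussianInt.intCast_re] at h1
  rw [← GaussianInt.intCast_im] at h2
  have h3 := Int.le_ceil R
  have hR : ∀ n : ℤ, -R ≤ n ∧ (n : ℝ) ≤ R → n ∈ Set.Icc (-⌈R⌉) ⌈R⌉ := by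
    rintro n ⟨ha, hb⟩
    constructor
    · have : (-⌈R⌉ : ℝ) ≤ n := by linarith
      exact_mod_cast this
    · have : (n : ℝ) ≤ ⌈R⌉ := by linarith
      exact_mod_cast this
  exact ⟨hR _ h1, hR _ h2⟩

theorem finite_candidates (k : ℕ) (w : ℂ × ℂ) : (candidates k w).Finite := by
  set S : Set ℂ := {1 / (1 + Complex.I), 1, 1 + Complex.I} with hS
  have hfin : S.Finite := by simp [hS]
  refine Set.Finite.subset (hfin.biUnion (t := fun a =>
    (fun g : GaussianInt => (a, g)) '' {g | ‖(g : ℂ)‖ ≤ 1 + ‖a / w.1‖ + ‖a‖})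
    fun a _ => (finite_norm_le _).image _) ?_
  rintro ⟨a, g⟩ hp
  have key : ∀ z : ℂ, ‖z - g‖ < 1 → ‖(g : ℂ)‖ ≤ 1 + ‖z‖ := by
    intro z hz
    have := norm_sub_norm_le (g : ℂ) z
    rw [norm_sub_rev] at this
    linarith
  unfold candidates at hp
  split_ifs at hp
  · obtain ⟨h1, h2⟩ := hp
    simp only at h1 h2
    refine Set.mem_biUnion (x := a) (by rw [h1]; simp [hS]) ⟨g, ?_, rfl⟩
    exact (key _ h2).trans (by linarith [norm_add_le (a / w.1) a])
  · obtain ⟨h1, h2⟩ := hp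
    simp only at h1 h2
    refine Set.mem_biUnion (x := a) ?_ ⟨g, ?_, rfl⟩
    · rcases h1 with h1 | h1 <;> rw [h1] <;> simp [hS]
    · exact (key _ h2).trans (by linarith [norm_nonneg a])

theorem candidates_nonempty (k : ℕ) (w : ℂ × ℂ) : (candidates k w).Nonempty := by
  have lt1 : ∀ z : ℂ, ‖z‖ ^ 2 ≤ 1 / 2 → ‖z‖ < 1 := fun z hz => by nlinarith [norm_nonneg z]
  unfold candidates
  split_ifs
  · obtain ⟨g, hg⟩ := exists_near (1 / (1 + Complex.I) / w.1 + 1 / (1 + Complex.I))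
    exact ⟨(_, g), rfl, lt1 _ hg⟩
  · obtain ⟨g, hg⟩ := exists_near (1 / w.1)
    exact ⟨(1, g), Or.inl rfl, lt1 _ hg⟩

theorem Reduced.one_lt_norm_snd {k : ℕ} {w : ℂ × ℂ} (hw : Reduced k w) {z : ℂ × ℂ}
    (hz : z ∈ normLattice k w) (hz0 : z ≠ 0) (hz1 : ‖z.1‖ < ‖w.1‖) : 1 < ‖z.2‖ := by
  by_contra! hcon
  have h1 := hw.norm_fst
  obtain ⟨α, hα, rfl | rfl⟩ := hw.eq_unit_smul hz hz0
    (by rw [Prod.norm_def]; exact max_le (hz1.trans h1).le hcon)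
  · rw [Prod.smul_fst, norm_smul, norm_of_mem_U4 hα] at hz1
    simp only [baseU, norm_one] at hz1
    linarith
  · rw [Prod.smul_fst, norm_smul, norm_of_mem_U4 hα] at hz1
    simp [baseV] at hz1

/-- The only difficulty is the coefficient 1 + i when k = 2, which is not allowed there. That vector
equals −U + (g − 1)V with g odd, and the field `next` of `Reduced2` yields a competitor that is at
least as good. -/
theorem Reduced.exists_candidate_le {k : ℕ} {w : ℂ × ℂ} (hw : Reduced k w) {y : ℂ × ℂ}
    (hy : y ∈ normLattice k w) (hy0 : y ≠ 0) (hy1 : ‖y.1‖ < ‖w.1‖) :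
    ∃ p ∈ candidates k w, ‖(nextVec k w p).2‖ ≤ ‖y.2‖ := by
  have h0 := hw.fst_ne
  obtain ⟨a, g, ha, h1, h2⟩ := exists_next_le (b := baseB k w) (v := baseV w)
    (fun z hz hz0 hz1 => by
      simp only [baseV, norm_one]; exact hw.one_lt_norm_snd hz hz0 hz1) hy hy0 hy1
  rcases hw with ⟨rfl, hw⟩ | ⟨rfl, hw⟩
  · refine ⟨((a : ℂ), g), (mem_candidates_iff h0).2 ⟨?_, ?_⟩, ?_⟩
    · rw [if_neg (by norm_num)]
      rcases ha with rfl | ⟨rfl, -⟩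
      · left; simp
      · right; exact onePlusI_coe
    · rw [nextVec_one]; exact h1
    · rw [nextVec_one]; exact h2
  · rcases ha with rfl | ⟨rfl, hg⟩
    · refine ⟨(1 / (1 + Complex.I), g), (mem_candidates_iff h0).2 ⟨by simp, ?_⟩, ?_⟩
      · rw [nextVec_two]; exact h1
      · rw [nextVec_two]; exact h2
    · have hX : (-onePlusI : ℂ) • baseB 2 w + (g : ℂ) • baseV w =
          (-1 : ℂ) • baseU w + ((g - 1 : GaussianInt) : ℂ) • baseV w := by
        rw [neg_smul, onePlusI_coe, one_add_I_smul_baseB, map_sub, map_one]; module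
      rw [hX] at h1 h2
      simp only [baseU, baseV, Prod.fst_add, Prod.snd_add, Prod.smul_fst, Prod.smul_snd,
        smul_eq_mul, mul_one] at h1 h2
      have hg' : onePlusI ∣ g - 1 := by
        rw [onePlusI_dvd_iff] at *; simp; omega
      obtain ⟨m, hm1, hm2, hm3⟩ := hw.next (g - 1) hg' (by
        rw [← norm_neg, neg_sub, sub_eq_neg_add]; exact h1)
      -- A unit is odd, so m + 1 = (1 + i)h and (−U + mV)/(1 + i) = −b + hV.
      have hm : onePlusI ∣ m + 1 := by
        rcases onePlusI_dvd_iff (m + 1) with hm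
        rw [hm]
        rw [norm_eq_re_im] at hm1
        have e1 : (m.re ^ 2 + m.im ^ 2) % 2 = (m.re + m.im) % 2 := by
          rcases Int.emod_two_eq_zero_or_one m.re with h | h <;>
          rcases Int.emod_two_eq_zero_or_one m.im with h' | h' <;>
          simp [Int.add_emod, pow_two, Int.mul_emod, h, h']
        simp; omega
      obtain ⟨h, hh⟩ := hm
      have hhc : (m : ℂ) + 1 = (1 + Complex.I) * h := by
        rw [← onePlusI_coe, ← map_mul, ← hh, map_add, map_one]
      have hZ : (1 + Complex.I) • nextVec 2 w (1 / (1 + Complex.I), h) =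
          (-1 : ℂ) • baseU w + (m : ℂ) • baseV w := by
        rw [nextVec_two, smul_add, smul_comm, one_add_I_smul_baseB, smul_smul, ← hhc, map_one]
        module
      set Z := nextVec 2 w (1 / (1 + Complex.I), h) with hZdef
      have hs : 0 < √2 := by positivity
      refine ⟨(1 / (1 + Complex.I), h), (mem_candidates_iff h0).2 ⟨by simp, ?_⟩, ?_⟩
      · have := congrArg (fun z : ℂ × ℂ => ‖z.1‖) hZ
        simp only [baseU, baseV, Prod.fst_add, Prod.smul_fst, smul_eq_mul, norm_mul,
          norm_one_add_I, mul_one] at this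
        rw [← norm_neg (-1 + _)] at this
        rw [← mul_lt_mul_iff_right₀ hs, ← hZdef, this]
        rwa [neg_add, neg_neg, ← sub_eq_add_neg]
      · have := congrArg (fun z : ℂ × ℂ => ‖z.2‖) hZ
        simp only [baseU, baseV, Prod.snd_add, Prod.smul_snd, smul_eq_mul, norm_mul,
          norm_one_add_I, mul_one] at this
        rw [← mul_le_mul_iff_right₀ hs, ← hZdef, this]
        refine le_trans (le_of_eq ?_) (hm3.trans (mul_le_mul_of_nonneg_left
          (le_trans (le_of_eq ?_) h2) hs.le))
        · congr 1; ring
        · congr 1; ring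

theorem Reduced.one_sub_ne_zero {k : ℕ} {w : ℂ × ℂ} (hw : Reduced k w) : 1 - w.1 * w.2 ≠ 0 := by
  intro h
  have h1 : ‖w.1‖ * ‖w.2‖ = 1 := by rw [← norm_mul, ← sub_eq_zero.1 h, norm_one]
  nlinarith [hw.norm_fst, hw.norm_snd, norm_nonneg w.1, norm_nonneg w.2]

/-- No two independent vectors of `L` have coordinates of equal moduli. -/
def Generic (L : Set (ℂ × ℂ)) : Prop :=
  ∀ x ∈ L, ∀ y ∈ L, LinearIndependent ℂ ![x, y] → ‖x.1‖ ≠ ‖y.1‖ ∧ ‖x.2‖ ≠ ‖y.2‖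

theorem Generic.exists_smul_eq {L : Set (ℂ × ℂ)} (hL : Generic L) {x y : ℂ × ℂ} (hx : x ∈ L)
    (hy : y ∈ L) (hx2 : x.2 ≠ 0) (h : ‖x.2‖ = ‖y.2‖) : ∃ c : ℂ, ‖c‖ = 1 ∧ c • x = y := by
  have hx0 : x ≠ 0 := by rintro rfl; exact hx2 rfl
  by_contra! hcon
  refine (hL x hx y hy ((LinearIndependent.pair_iff' hx0).2 fun c hc => ?_)).2 h
  refine hcon c ?_ hc
  have hp := norm_pos_iff.2 hx2
  rw [← hc, Prod.smul_snd, norm_smul] at h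
  exact (mul_right_cancel₀ hp.ne' ((one_mul _).trans h)).symm

theorem nextVec_ne_zero {k : ℕ} {w : ℂ × ℂ} (hw : Reduced k w) {p : ℂ × GaussianInt}
    (hp : p ∈ candidates k w) : nextVec k w p ≠ 0 := by
  intro h
  have h1 := det_baseV_nextVec k w p
  rw [h] at h1
  simp only [det, Prod.fst_zero, Prod.snd_zero, mul_zero, sub_zero] at h1
  have ha : p.1 ≠ 0 := by
    have h2 := ((mem_candidates_iff hw.fst_ne).1 hp).1
    split_ifs at h2
    · rw [h2]; exact one_div_ne_zero one_add_I_ne_zero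
    · rcases h2 with h2 | h2 <;> rw [h2]
      exacts [one_ne_zero, one_add_I_ne_zero]
  exact mul_ne_zero ha hw.one_sub_ne_zero h1.symm

/-- By genericity the vectors differ by a factor c of modulus 1. Determinants against V show that c
carries one coefficient a to the other; as |1| ≠ |1 + i|, the coefficients coincide, c = 1, and the
integers g coincide. -/
theorem eq_of_norm_snd_eq {k : ℕ} (hk : k = 1 ∨ k = 2) {w : ℂ × ℂ} (hw : Reduced k w)
    (hL : Generic (normLattice k w)) {p q : ℂ × GaussianInt} (hp : p ∈ candidates k w)
    (hq : q ∈ candidates k w) (h : ‖(nextVec k w p).2‖ = ‖(nextVec k w q).2‖) : p = q := by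
  have hp' := (mem_candidates_iff hw.fst_ne).1 hp
  have hq' := (mem_candidates_iff hw.fst_ne).1 hq
  have hp2 := hw.one_lt_norm_snd (nextVec_mem hk hp) (nextVec_ne_zero hw hp) hp'.2
  have hp0 : (nextVec k w p).2 ≠ 0 := norm_pos_iff.1 (zero_lt_one.trans hp2)
  obtain ⟨c, hc, hpq⟩ := hL.exists_smul_eq (nextVec_mem hk hp) (nextVec_mem hk hq) hp0 h
  have hdet : c * p.1 = q.1 := by
    have h1 := det_baseV_nextVec k w p
    have h2 := det_baseV_nextVec k w q
    rw [← hpq] at h2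
    apply mul_right_cancel₀ hw.one_sub_ne_zero
    rw [← h2, mul_assoc, ← h1]
    simp only [det, Prod.smul_fst, Prod.smul_snd, smul_eq_mul]
    ring
  have hnorm : ‖p.1‖ = ‖q.1‖ := by rw [← hdet, norm_mul, hc, one_mul]
  have s1 : (1 : ℝ) < √2 := by rw [Real.lt_sqrt] <;> norm_num
  have hpq1 : p.1 = q.1 ∧ p.1 ≠ 0 := by
    have h1 := hp'.1
    have h2 := hq'.1
    split_ifs at h1 h2
    · rw [h1, h2]; exact ⟨rfl, one_div_ne_zero one_add_I_ne_zero⟩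
    · rcases h1 with h1 | h1 <;> rcases h2 with h2 | h2 <;> rw [h1, h2] at hnorm <;>
        simp only [norm_one, norm_one_add_I] at hnorm <;> rw [h1, h2]
      · exact ⟨rfl, one_ne_zero⟩
      · exact absurd hnorm s1.ne
      · exact absurd hnorm s1.ne'
      · exact ⟨rfl, one_add_I_ne_zero⟩
  have hc1 : c = 1 := by
    rw [← hpq1.1] at hdet
    exact mul_right_cancel₀ hpq1.2 (hdet.trans (one_mul _).symm)
  rw [hc1, one_smul] at hpq
  have h3 := congrArg Prod.snd hpq
  rw [nextVec_snd, nextVec_snd, hpq1.1] at h3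
  refine Prod.ext hpq1.1 (GaussianInt.toComplex_injective ?_)
  split_ifs at h3 <;> exact add_left_cancel h3

theorem exists_minimal_candidate {k : ℕ} (hk : k = 1 ∨ k = 2) {w : ℂ × ℂ} (hw : Reduced k w)
    (hL : Generic (normLattice k w)) :
    ∃ p ∈ candidates k w, (∀ q ∈ candidates k w, ‖(nextVec k w p).2‖ ≤ ‖(nextVec k w q).2‖) ∧
      ∀ q, IsMinimalCoeff k w q ↔ q = p := by
  obtain ⟨p, hp, hmin⟩ := Set.exists_min_image _ (fun p => ‖(nextVec k w p).2‖)
    (finite_candidates k w) (candidates_nonempty k w)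
  refine ⟨p, hp, hmin, fun q => ⟨fun hq => ?_, ?_⟩⟩
  · refine eq_of_norm_snd_eq hk hw hL hq.1 hp (le_antisymm ?_ (hmin q hq.1))
    by_contra! hlt
    rcases hq.2 p hp (Or.inl hlt) with h | h
    · linarith
    · linarith [h.1]
  · rintro rfl
    refine ⟨hp, fun q hq hle => ?_⟩
    have h : ‖(nextVec k w q).2‖ ≤ ‖(nextVec k w _).2‖ := hle.elim le_of_lt (fun h => h.1.le)
    rw [eq_of_norm_snd_eq hk hw hL hq hp (h.antisymm (hmin q hq))] at hle ⊢
    exact hle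

theorem coeff_spec {k : ℕ} (hk : k = 1 ∨ k = 2) {w : ℂ × ℂ} (hw : Reduced k w)
    (hL : Generic (normLattice k w)) :
    coeff k w ∈ candidates k w ∧
      (∀ q ∈ candidates k w, ‖(nextVec k w (coeff k w)).2‖ ≤ ‖(nextVec k w q).2‖) ∧
      ∀ q, IsMinimalCoeff k w q ↔ q = coeff k w := by
  obtain ⟨p, hp, hmin, hiff⟩ := exists_minimal_candidate hk hw hL
  have h : coeff k w = p := (hiff _).1 (Classical.epsilon_spec ⟨p, (hiff p).2 rfl⟩)
  rw [h]
  exact ⟨hp, hmin, hiff⟩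

theorem TG_eq {k : ℕ} {w : ℂ × ℂ} (h0 : w.1 ≠ 0) :
    TG k w = ((nextVec k w (coeff k w)).1 / w.1, 1 / (nextVec k w (coeff k w)).2) := by
  rw [nextVec_fst, nextVec_snd]
  unfold TG coeffA coeffG
  split_ifs
  · refine Prod.ext ?_ ?_
    · simp only; field_simp; ring
    · simp only; congr 1; ring
  · refine Prod.ext ?_ ?_
    · simp only; field_simp; ring
    · simp only; congr 1; ring

/-! ### The lattices `Ψ_k(θ,w)` as scaled normalized lattices -/

/-- The factor of the first coordinate in the parametrization. -/
noncomputable def factor1 (k : ℕ) (θ : ℝ) (w : ℂ × ℂ) : ℂ := radius k w * unit1 θ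

/-- The factor of the second coordinate in the parametrization. -/
noncomputable def factor2 (k : ℕ) (θ : ℝ) (w : ℂ × ℂ) : ℂ := radius k w * unit2 k θ w

/-- The determinant of the pair `vecU`, `vecV`. -/
noncomputable def pairDet (k : ℕ) : ℂ := if k = 2 then 1 + Complex.I else 1

theorem latticeSpan_half_sum (u v : ℂ × ℂ) :
    latticeSpan u ((1 / (1 + Complex.I)) • (u + v)) =
      latticeSpan ((1 / (1 + Complex.I)) • (u + v)) v := by
  set b := (1 / (1 + Complex.I)) • (u + v) with hb
  have h : (1 + Complex.I) • b = u + v := by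
    rw [hb, smul_smul, mul_one_div_cancel one_add_I_ne_zero, one_smul]
  rw [← onePlusI_coe] at h
  refine Set.Subset.antisymm (latticeSpan_subset ⟨onePlusI, -1, ?_⟩ (left_mem_latticeSpan _ _))
    (latticeSpan_subset (right_mem_latticeSpan _ _) ⟨-1, onePlusI, ?_⟩)
  · rw [h, map_neg, map_one]; module
  · rw [h, map_neg, map_one]; module

theorem scale_baseB_two (c d : ℂ) (w : ℂ × ℂ) :
    (c * (baseB 2 w).1, d * (baseB 2 w).2) = (1 / (1 + Complex.I)) •
      ((c * (baseU w).1, d * (baseU w).2) + (c * (baseV w).1, d * (baseV w).2)) := by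
  ext <;> simp [baseB] <;> ring

theorem vecU_eq (k : ℕ) (θ : ℝ) (w : ℂ × ℂ) :
    vecU k θ w = (factor1 k θ w * (baseU w).1, factor2 k θ w * (baseU w).2) := by
  simp [vecU, baseU, factor1, factor2, mul_assoc]

theorem vecV_eq (k : ℕ) (θ : ℝ) (w : ℂ × ℂ) :
    vecV k θ w = (factor1 k θ w * (baseV w).1, factor2 k θ w * (baseV w).2) := by
  simp [vecV, baseV, factor1, factor2, mul_assoc]

theorem Psi_eq_scale (k : ℕ) (θ : ℝ) (w : ℂ × ℂ) :
    Psi k θ w = scale (factor1 k θ w) (factor2 k θ w) (normLattice k w) := by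
  rw [normLattice, scale_latticeSpan, ← vecV_eq]
  unfold Psi
  split_ifs with hk
  · rw [latticeSpan_half_sum, hk, scale_baseB_two, ← vecU_eq, ← vecV_eq]
  · rw [baseB, if_neg hk, ← vecU_eq]

theorem norm_unit1 (θ : ℝ) : ‖unit1 θ‖ = 1 := by
  rw [unit1, mul_comm, Complex.norm_exp_ofReal_mul_I]

theorem norm_unit2 (k : ℕ) (θ : ℝ) (w : ℂ × ℂ) : ‖unit2 k θ w‖ = 1 := by
  rw [unit2, mul_comm, Complex.norm_exp_ofReal_mul_I]

theorem radius_pos {k : ℕ} (hk : k = 1 ∨ k = 2) {w : ℂ × ℂ} (hw : 1 - w.1 * w.2 ≠ 0) :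
    0 < radius k w := by
  have : (0 : ℝ) < k := by rcases hk with rfl | rfl <;> norm_num
  have := norm_pos_iff.2 hw
  unfold radius
  positivity

theorem norm_factor1 {k : ℕ} (hk : k = 1 ∨ k = 2) {w : ℂ × ℂ} (hw : 1 - w.1 * w.2 ≠ 0) (θ : ℝ) :
    ‖factor1 k θ w‖ = radius k w := by
  rw [factor1, norm_mul, norm_unit1, mul_one, Complex.norm_real,
    Real.norm_of_nonneg (radius_pos hk hw).le]

theorem norm_factor2 {k : ℕ} (hk : k = 1 ∨ k = 2) {w : ℂ × ℂ} (hw : 1 - w.1 * w.2 ≠ 0) (θ : ℝ) :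
    ‖factor2 k θ w‖ = radius k w := by
  rw [factor2, norm_mul, norm_unit2, mul_one, Complex.norm_real,
    Real.norm_of_nonneg (radius_pos hk hw).le]

theorem one_add_I_eq_exp :
    1 + Complex.I = (√2 : ℝ) * Complex.exp ((Real.pi / 4 : ℝ) * Complex.I) := by
  rw [Complex.exp_mul_I, ← Complex.ofReal_cos, ← Complex.ofReal_sin, Real.cos_pi_div_four,
    Real.sin_pi_div_four]
  have h : ((√2 : ℝ) : ℂ) * ((√2 : ℝ) : ℂ) = 2 := by
    rw [← Complex.ofReal_mul, Real.mul_self_sqrt zero_le_two]; norm_num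
  push_cast
  linear_combination -(1 + Complex.I) / 2 * h

/-- The radius makes the modulus √k, and the phase of `unit2` cancels arg(1 − w₁w₂), leaving
e^{i(k−1)π/4}. This is why the parametrized lattices are unimodular. -/
theorem factor1_mul_factor2 {k : ℕ} (hk : k = 1 ∨ k = 2) (θ : ℝ) {w : ℂ × ℂ}
    (hw : 1 - w.1 * w.2 ≠ 0) :
    factor1 k θ w * factor2 k θ w * (1 - w.1 * w.2) = pairDet k := by
  have hpos := norm_pos_iff.2 hw
  have hr : radius k w ^ 2 * ‖1 - w.1 * w.2‖ = √k := by
    rw [radius, div_pow, Real.sq_sqrt hpos.le, div_mul_cancel₀ _ hpos.ne',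
      ← Real.rpow_natCast, ← Real.rpow_mul (Nat.cast_nonneg k), Real.sqrt_eq_rpow]
    norm_num
  have hu : unit1 θ * unit2 k θ w * Complex.exp (Complex.arg (1 - w.1 * w.2) * Complex.I) =
      Complex.exp ((((k : ℝ) - 1) * (Real.pi / 4) : ℝ) * Complex.I) := by
    rw [unit1, unit2, ← Complex.exp_add, ← Complex.exp_add]
    congr 1
    push_cast
    ring
  have hp : factor1 k θ w * factor2 k θ w * (1 - w.1 * w.2) =
      (√k : ℝ) * Complex.exp ((((k : ℝ) - 1) * (Real.pi / 4) : ℝ) * Complex.I) := by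
    rw [← hu, ← hr, factor1, factor2]
    nth_rewrite 1 [← Complex.norm_mul_exp_arg_mul_I (1 - w.1 * w.2)]
    push_cast
    ring
  rw [hp]
  rcases hk with rfl | rfl
  · simp [pairDet]
  · rw [pairDet, if_pos rfl, one_add_I_eq_exp]
    norm_num

theorem det_baseB_baseV (k : ℕ) (w : ℂ × ℂ) :
    det (baseB k w) (baseV w) * pairDet k = 1 - w.1 * w.2 := by
  unfold baseB pairDet det
  split_ifs
  · simp only [baseU, baseV, Prod.smul_fst, Prod.smul_snd, Prod.fst_add, Prod.snd_add,
      smul_eq_mul]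
    field_simp [one_add_I_ne_zero]
    ring
  · simp only [baseU, baseV]
    ring

theorem pairDet_ne_zero (k : ℕ) : pairDet k ≠ 0 := by
  unfold pairDet
  split_ifs
  exacts [one_add_I_ne_zero, one_ne_zero]

theorem Psi_mem_Omega1 {k : ℕ} (hk : k = 1 ∨ k = 2) (θ : ℝ) {w : ℂ × ℂ}
    (hw : 1 - w.1 * w.2 ≠ 0) : Psi k θ w ∈ Omega1 := by
  rw [Psi_eq_scale, normLattice, scale_latticeSpan]
  refine ⟨_, _, ?_, rfl⟩
  have h1 := factor1_mul_factor2 hk θ hw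
  rw [← det_baseB_baseV k w] at h1
  have h : det (factor1 k θ w * (baseB k w).1, factor2 k θ w * (baseB k w).2)
      (factor1 k θ w * (baseV w).1, factor2 k θ w * (baseV w).2) = 1 := by
    apply mul_right_cancel₀ (pairDet_ne_zero k)
    have h2 : det (factor1 k θ w * (baseB k w).1, factor2 k θ w * (baseB k w).2)
        (factor1 k θ w * (baseV w).1, factor2 k θ w * (baseV w).2) =
        factor1 k θ w * factor2 k θ w * det (baseB k w) (baseV w) := by
      simp only [det]; ring
    rw [h2]
    linear_combination h1
  rw [h]
  exact one_pow 4

theorem generic_of_Psi_not_mem {k : ℕ} (hk : k = 1 ∨ k = 2) {θ : ℝ} {w : ℂ × ℂ}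
    (hw : 1 - w.1 * w.2 ≠ 0) (h : Psi k θ w ∉ negligibleSet) : Generic (normLattice k w) := by
  intro x hx y hy hxy
  have hr := radius_pos hk hw
  have n1 := norm_factor1 hk hw θ
  have n2 := norm_factor2 hk hw θ
  have c1 : factor1 k θ w ≠ 0 := by rw [← norm_pos_iff, n1]; exact hr
  have c2 : factor2 k θ w ≠ 0 := by rw [← norm_pos_iff, n2]; exact hr
  by_contra hcon
  refine h ⟨Psi_mem_Omega1 hk θ hw, Or.inr ?_⟩
  rw [Psi_eq_scale]
  refine ⟨_, ⟨x, hx, rfl⟩, _, ⟨y, hy, rfl⟩, ?_, ?_⟩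
  · rw [LinearIndependent.pair_iff] at hxy ⊢
    intro s t hst
    refine hxy s t (Prod.ext (mul_left_cancel₀ c1 ?_) (mul_left_cancel₀ c2 ?_))
    · have := congrArg Prod.fst hst
      simp only [Prod.fst_add, Prod.smul_fst, smul_eq_mul, Prod.fst_zero] at this ⊢
      linear_combination this
    · have := congrArg Prod.snd hst
      simp only [Prod.snd_add, Prod.smul_snd, smul_eq_mul, Prod.snd_zero] at this ⊢
      linear_combination this
  · simp only [norm_mul, n1, n2, mul_right_inj' hr.ne']
    tauto

/-! ### The new normalized pair -/

/-- The index of the component that contains `T_G(w)`. -/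
noncomputable def nextIndex (k : ℕ) (w : ℂ × ℂ) : ℕ :=
  if coeffA k w = 1 + Complex.I then 2 else 1

theorem inv_one_add_I_ne : 1 / (1 + Complex.I) ≠ 1 + Complex.I := by
  intro h
  have := congrArg norm h
  rw [norm_inv_one_add_I, norm_one_add_I, div_eq_iff (by positivity),
    Real.mul_self_sqrt zero_le_two] at this
  norm_num at this

theorem pairDet_nextIndex {k : ℕ} (hk : k = 1 ∨ k = 2) {w : ℂ × ℂ}
    (hc : coeff k w ∈ candidates k w) :
    pairDet (nextIndex k w) = pairDet k * coeffA k w := by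
  rcases hk with rfl | rfl
  · rcases hc.1 with h | h <;> rw [nextIndex, coeffA, h]
    · have : (1 : ℂ) ≠ 1 + Complex.I := by simp
      simp [pairDet, this]
    · simp [pairDet]
  · have h : coeffA 2 w = 1 / (1 + Complex.I) := hc.1
    rw [nextIndex, h, if_neg inv_one_add_I_ne]
    simp only [pairDet, if_pos, OfNat.one_ne_ofNat, if_false]
    rw [mul_one_div_cancel one_add_I_ne_zero]

/-- Otherwise division by 1 + i produces a competitor with a = 1 and a smaller second modulus. -/
theorem not_onePlusI_dvd_of_minimal {w : ℂ × ℂ} {g : GaussianInt} (hw : w.1 ≠ 0)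
    (hp : (1 + Complex.I, g) ∈ candidates 1 w)
    (h0 : (nextVec 1 w (1 + Complex.I, g)).2 ≠ 0)
    (hmin : ∀ q ∈ candidates 1 w, ‖(nextVec 1 w (1 + Complex.I, g)).2‖ ≤ ‖(nextVec 1 w q).2‖) :
    ¬ onePlusI ∣ g := by
  rintro ⟨h, rfl⟩
  have hX : nextVec 1 w (1 + Complex.I, onePlusI * h) = (1 + Complex.I) • nextVec 1 w (1, h) := by
    rw [nextVec_one, nextVec_one, map_mul, onePlusI_coe]; module
  have s1 : (1 : ℝ) < √2 := by rw [Real.lt_sqrt] <;> norm_num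
  rw [hX] at hmin h0
  have hp2 := ((mem_candidates_iff hw).1 hp).2
  rw [hX, Prod.smul_fst, norm_smul, norm_one_add_I] at hp2
  have hq : (1, h) ∈ candidates 1 w := (mem_candidates_iff hw).2
    ⟨by simp, by nlinarith [norm_nonneg (nextVec 1 w (1, h)).1]⟩
  have := hmin _ hq
  rw [Prod.smul_snd, norm_smul, norm_one_add_I] at this
  have : 0 < ‖(nextVec 1 w (1, h)).2‖ :=
    norm_pos_iff.2 (right_ne_zero_of_mul h0)
  nlinarith

/-- The matrix diag(w₁, X₂) carries the normalized pair with parameters T_G(w) to (V, X). If a is 1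
or 1/(1 + i), then X = −b + gV and (V, X) is a basis. If a = 1 + i, then g is odd, so (V + X)/(1 +
i) is in the lattice and forms a basis with X. -/
theorem normLattice_eq_scale_TG {k : ℕ} (hk : k = 1 ∨ k = 2) {w : ℂ × ℂ} (hw : Reduced k w)
    (hc : coeff k w ∈ candidates k w)
    (hmin : ∀ q ∈ candidates k w, ‖(nextVec k w (coeff k w)).2‖ ≤ ‖(nextVec k w q).2‖) :
    normLattice k w = scale w.1 (nextVec k w (coeff k w)).2
      (normLattice (nextIndex k w) (TG k w)) := by
  have h0 := hw.fst_ne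
  have hX2 := hw.one_lt_norm_snd (nextVec_mem hk hc) (nextVec_ne_zero hw hc)
    ((mem_candidates_iff h0).1 hc).2
  have hX0 : (nextVec k w (coeff k w)).2 ≠ 0 := norm_pos_iff.1 (zero_lt_one.trans hX2)
  rw [TG_eq h0, normLattice, normLattice, scale_latticeSpan]
  set X := nextVec k w (coeff k w) with hX
  have hV : (w.1 * (baseV (X.1 / w.1, 1 / X.2)).1, X.2 * (baseV (X.1 / w.1, 1 / X.2)).2) = X := by
    ext
    · simp only [baseV]; field_simp
    · simp only [baseV]; ring
  have hU : (w.1 * (baseU (X.1 / w.1, 1 / X.2)).1, X.2 * (baseU (X.1 / w.1, 1 / X.2)).2) =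
      baseV w := by
    ext
    · simp only [baseU, baseV]; ring
    · simp only [baseU, baseV]; field_simp
  rw [hV]
  have case_one : ∀ g : GaussianInt,
      X = (-(1 : GaussianInt) : ℂ) • baseB k w + (g : ℂ) • baseV w →
      latticeSpan (baseB k w) (baseV w) = latticeSpan (baseV w) X := by
    intro g hg
    refine Set.Subset.antisymm (latticeSpan_subset ⟨g, -1, ?_⟩ (left_mem_latticeSpan _ _))
      (latticeSpan_subset (right_mem_latticeSpan _ _) ⟨-1, g, ?_⟩)
    · rw [hg]; simp only [map_neg, map_one]; module
    · rw [hg]; simp only [map_neg, map_one]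
  rcases hk with rfl | rfl
  · rcases hc.1 with h | h
    · have hj : nextIndex 1 w = 1 := by
        rw [nextIndex, coeffA, h, if_neg (by simp)]
      rw [hj]
      simp only [baseB, OfNat.one_ne_ofNat, if_false] at case_one ⊢
      rw [hU]
      refine case_one (coeff 1 w).2 ?_
      rw [hX, nextVec_one, h]
      simp [baseB]
    · have hj : nextIndex 1 w = 2 := by
        rw [nextIndex, coeffA, h, if_pos rfl]
      rw [hj]
      have hB : (w.1 * (baseB 2 (X.1 / w.1, 1 / X.2)).1, X.2 * (baseB 2 (X.1 / w.1, 1 / X.2)).2) =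
          (1 / (1 + Complex.I)) • (baseV w + X) := by
        rw [scale_baseB_two, hU, hV]
      rw [hB, baseB, if_neg (by norm_num)]
      have hXg : X = -((1 + Complex.I) : ℂ) • baseU w + ((coeff 1 w).2 : ℂ) • baseV w := by
        rw [hX, nextVec_one, h]; simp [baseB]
      have hgodd : ¬ onePlusI ∣ (coeff 1 w).2 := by
        have e : coeff 1 w = (1 + Complex.I, (coeff 1 w).2) := Prod.ext h rfl
        refine not_onePlusI_dvd_of_minimal h0 (e ▸ hc) ?_ ?_
        · rw [← e]; exact hX0
        · rw [← e]; exact hmin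
      generalize (coeff 1 w).2 = g at hXg hgodd
      have hg1 : onePlusI ∣ g + 1 := by
        rw [onePlusI_dvd_iff] at *; simp; omega
      obtain ⟨m, hm⟩ := hg1
      have hmc : (g : ℂ) = (1 + Complex.I) * m - 1 := by
        rw [← onePlusI_coe, ← map_mul, ← hm, map_add, map_one]; ring
      have hb : (1 / (1 + Complex.I)) • (baseV w + X) = (-1 : ℂ) • baseU w + (m : ℂ) • baseV w := by
        have h1 : baseV w + X = (1 + Complex.I) • ((-1 : ℂ) • baseU w + (m : ℂ) • baseV w) := by
          rw [hXg, hmc]; module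
        rw [h1, smul_smul, one_div_mul_cancel one_add_I_ne_zero, one_smul]
      rw [hb, hXg, hmc, ← onePlusI_coe]
      refine Set.Subset.antisymm
        (latticeSpan_subset ⟨m * onePlusI - 1, -m, ?_⟩ ⟨onePlusI, -1, ?_⟩)
        (latticeSpan_subset ⟨-1, m, ?_⟩ ⟨-onePlusI, onePlusI * m - 1, ?_⟩)
      all_goals simp only [map_neg, map_one, map_mul, map_sub] <;> try module
  · have h : coeffA 2 w = 1 / (1 + Complex.I) := hc.1
    have hj : nextIndex 2 w = 1 := by
      rw [nextIndex, h, if_neg inv_one_add_I_ne]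
    rw [hj]
    have e : coeff 2 w = (1 / (1 + Complex.I), (coeff 2 w).2) := Prod.ext h rfl
    rw [case_one (coeff 2 w).2 (by rw [hX, e, nextVec_two])]
    rw [baseB, if_neg (by norm_num), hU]

/-- Since α⁻² = α², diag(α⁻¹, α) sends U and V to α⁻¹ and α times the corresponding vectors for α²w.
For j = 2 the half sum is also respected, because α ≡ α⁻¹ modulo 1 + i. -/
theorem scale_normLattice_unit (j : ℕ) {α : ℂ} (hα : α ∈ U4) (w : ℂ × ℂ) :
    normLattice j (α ^ 2 • w) = scale α⁻¹ α (normLattice j w) := by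
  obtain ⟨e, he, rfl⟩ := exists_coe_of_mem_U4 hα
  have h4 : (e : ℂ) ^ 4 = 1 := hα
  have he0 : (e : ℂ) ≠ 0 := by rintro h; rw [h] at h4; norm_num at h4
  have hinv : (e : ℂ)⁻¹ = (e : ℂ) ^ 3 := by
    apply mul_left_cancel₀ he0; rw [mul_inv_cancel₀ he0]; linear_combination -h4
  rw [normLattice, normLattice, scale_latticeSpan, hinv]
  have hV : ((e : ℂ) ^ 3 * (baseV w).1, (e : ℂ) * (baseV w).2) =
      (e : ℂ) • baseV ((e : ℂ) ^ 2 • w) := by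
    ext <;> simp [baseV]; ring
  have hU : ((e : ℂ) ^ 3 * (baseU w).1, (e : ℂ) * (baseU w).2) =
      (e : ℂ) ^ 3 • baseU ((e : ℂ) ^ 2 • w) := by
    ext
    · simp [baseU]
    · simp only [baseU, Prod.smul_snd, smul_eq_mul]; linear_combination -(e : ℂ) * w.2 * h4
  rw [hV]
  set u := baseU ((e : ℂ) ^ 2 • w) with hu
  set v := baseV ((e : ℂ) ^ 2 • w) with hv
  by_cases hj : j = 2
  · have hB : ((e : ℂ) ^ 3 * (baseB j w).1, (e : ℂ) * (baseB j w).2) =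
        (1 / (1 + Complex.I)) • ((e : ℂ) ^ 3 • u + (e : ℂ) • v) := by
      rw [← hU, ← hV, hj, scale_baseB_two]
    rw [hB, baseB, if_pos hj, ← hu, ← hv]
    -- The difference is 0 if e² = 1, and 2e = (1 + i)(1 − i)e if e² = −1.
    obtain ⟨f, hf⟩ : ∃ f : GaussianInt, (e : ℂ) - (e : ℂ) ^ 3 = (1 + Complex.I) * f := by
      have h2 : ((e : ℂ) ^ 2 - 1) * ((e : ℂ) ^ 2 + 1) = 0 := by linear_combination h4
      rcases mul_eq_zero.1 h2 with h | h
      · exact ⟨0, by rw [map_zero]; linear_combination -(e : ℂ) * h⟩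
      · refine ⟨⟨1, -1⟩ * e, ?_⟩
        have h5 : ((⟨1, -1⟩ : GaussianInt) : ℂ) = 1 - Complex.I := by
          rw [GaussianInt.toComplex_def']; push_cast; ring
        rw [map_mul, h5]
        linear_combination -(e : ℂ) * h + (e : ℂ) * Complex.I_sq
    set b := (1 / (1 + Complex.I)) • (u + v) with hb
    have hB2 : (1 / (1 + Complex.I)) • ((e : ℂ) ^ 3 • u + (e : ℂ) • v) =
        (e : ℂ) ^ 3 • b + (f : ℂ) • v := by
      have h1 : (e : ℂ) ^ 3 • u + (e : ℂ) • v =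
          (e : ℂ) ^ 3 • (u + v) + ((e : ℂ) - (e : ℂ) ^ 3) • v := by module
      have h2 : (1 / (1 + Complex.I)) • ((1 + Complex.I) * f) • v = (f : ℂ) • v := by
        rw [smul_smul, ← mul_assoc, one_div_mul_cancel one_add_I_ne_zero, one_mul]
      rw [h1, hf, smul_add, h2, smul_comm]
    rw [hB2]
    refine Set.Subset.antisymm
      (latticeSpan_subset ⟨e, -e ^ 4 * f, ?_⟩ ⟨0, e ^ 3, ?_⟩)
      (latticeSpan_subset ⟨e ^ 3, f, by simp⟩ ⟨0, e, by simp⟩)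
    · simp only [map_neg, map_mul, map_pow, smul_add, smul_smul, ← pow_succ', h4]; module
    · rw [map_zero, zero_smul, zero_add, map_pow, smul_smul, ← pow_succ, h4, one_smul]
  · have hB : ((e : ℂ) ^ 3 * (baseB j w).1, (e : ℂ) * (baseB j w).2) = (e : ℂ) ^ 3 • u := by
      rw [baseB, if_neg hj, hU]
    rw [hB, baseB, if_neg hj, ← hu]
    refine Set.Subset.antisymm
      (latticeSpan_subset ⟨e, 0, ?_⟩ ⟨0, e ^ 3, ?_⟩)
      (latticeSpan_subset ⟨e ^ 3, 0, by simp⟩ ⟨0, e, by simp⟩)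
    · rw [map_zero, zero_smul, add_zero, smul_smul, ← pow_succ', h4, one_smul]
    · rw [map_zero, zero_smul, zero_add, map_pow, smul_smul, ← pow_succ, h4, one_smul]

/-- A diagonal matrix with entries of equal modulus is determined by the phase of its first entry
and its determinant, which gives the common modulus. -/
theorem eq_and_eq_of_mul_eq {c d c' d' x : ℂ} {ρ ρ' : ℝ} (hρ : 0 < ρ) (hρ' : 0 < ρ')
    (hx : ‖x‖ = 1) (hc : c = ρ * x) (hc' : c' = ρ' * x) (hd : ‖d‖ = ρ) (hd' : ‖d'‖ = ρ')
    (h : c * d = c' * d') : c = c' ∧ d = d' := by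
  have h1 : ρ ^ 2 = ρ' ^ 2 := by
    have := congrArg norm h
    simpa [hc, hc', hx, hd, hd', abs_of_pos hρ, abs_of_pos hρ', sq] using this
  have h2 : ρ = ρ' := (sq_eq_sq₀ hρ.le hρ'.le).1 h1
  have h3 : c = c' := by rw [hc, hc', h2]
  have h4 : c ≠ 0 := by
    rw [hc, ← norm_pos_iff, norm_mul, hx, Complex.norm_real, Real.norm_of_nonneg hρ.le, mul_one]
    exact hρ
  refine ⟨h3, mul_left_cancel₀ h4 ?_⟩
  rw [h, h3]

/-! ### The first return map -/

theorem Reduced.eq_unit_smul_Psi {k : ℕ} (hk : k = 1 ∨ k = 2) {w : ℂ × ℂ} (hw : Reduced k w)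
    {θ : ℝ} {z : ℂ × ℂ} (hz : z ∈ Psi k θ w) (hz0 : z ≠ 0) (hz1 : ‖z‖ ≤ radius k w) :
    ∃ α ∈ U4, z = α • vecU k θ w ∨ z = α • vecV k θ w := by
  have h1 := hw.one_sub_ne_zero
  have hr := radius_pos hk h1
  rw [Psi_eq_scale] at hz
  obtain ⟨y, hy, rfl⟩ := hz
  have hy1 : ‖y‖ ≤ 1 := by
    simp only [Prod.norm_def, norm_mul, norm_factor1 hk h1, norm_factor2 hk h1, max_le_iff,
      mul_le_iff_le_one_right hr] at hz1 ⊢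
    exact hz1
  obtain ⟨α, hα, h⟩ := hw.eq_unit_smul hy (by rintro rfl; simp at hz0) hy1
  refine ⟨α, hα, h.imp ?_ ?_⟩
  · rintro rfl
    rw [vecU_eq]
    ext <;> simp <;> ring
  · rintro rfl
    rw [vecV_eq]
    ext <;> simp <;> ring

end GaussLattice

open GaussLattice in
theorem mainTheorem8 (k : ℕ) (hk : k = 1 ∨ k = 2) (θ : ℝ)
    (hθ : θ ∈ Set.Ico 0 (Real.pi / 2)) (w : ℂ × ℂ) (hw : w ∈ GaussLattice.W' k) :
    -- the lattice is in the open transversal, and it returns to the full transversal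
    GaussLattice.Psi k θ w ∈ GaussLattice.openTransversal ∧
    IsLeast (GaussLattice.returnTimes (GaussLattice.Psi k θ w))
      (GaussLattice.returnTime (GaussLattice.Psi k θ w)) ∧
    -- the map `T_G` is well defined at `w`, with value in `𝔻²`
    (∃! p : ℂ × GaussianInt, GaussLattice.IsMinimalCoeff k w p) ∧
    ‖(GaussLattice.TG k w).1‖ < 1 ∧ ‖(GaussLattice.TG k w).2‖ < 1 ∧
    -- the unit `α` exists and is unique
    (∃! α : ℂ, ∃ θ' : ℝ, GaussLattice.IsAngleChoice θ w.1 α θ') ∧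
    -- the formula for the first return map
    ∀ (α : ℂ) (θ' : ℝ), GaussLattice.IsAngleChoice θ w.1 α θ' →
      GaussLattice.firstReturn (GaussLattice.Psi k θ w) =
        GaussLattice.Psi (if GaussLattice.coeffA k w = 1 + Complex.I then 2 else 1) θ'
          (α ^ 2 • GaussLattice.TG k w) := by
  obtain ⟨hWk, θ₀, hθ₀⟩ := hw
  have hr := reduced_of_mem_W hk hWk
  have h0 := hr.fst_ne
  have h0' := norm_pos_iff.2 h0
  have h1 := hr.one_sub_ne_zero
  have hG := generic_of_Psi_not_mem hk h1 hθ₀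
  obtain ⟨hc, hmin, hiff⟩ := coeff_spec hk hr hG
  have hXmem := nextVec_mem hk hc
  have hX1 := ((mem_candidates_iff h0).1 hc).2
  have hX2 := hr.one_lt_norm_snd hXmem (nextVec_ne_zero hr hc) hX1
  have hdet := det_baseV_nextVec k w (coeff k w)
  have hlat := normLattice_eq_scale_TG hk hr hc hmin
  have hTG := TG_eq (k := k) h0
  have hj := pairDet_nextIndex hk hc
  set X := nextVec k w (coeff k w) with hX
  have hX0 : X.2 ≠ 0 := norm_pos_iff.1 (zero_lt_one.trans hX2)
  have hρ := radius_pos hk h1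
  have n1 := norm_factor1 hk h1 θ
  have n2 := norm_factor2 hk h1 θ
  have hL := Psi_mem_Omega1 hk θ h1
  have hT1 : ‖(TG k w).1‖ < 1 := by
    rw [hTG, norm_div, div_lt_one h0']; exact hX1
  have hT2 : ‖(TG k w).2‖ < 1 := by
    rw [hTG, norm_div, norm_one, div_lt_one (zero_lt_one.trans hX2)]; exact hX2
  have img : ∀ z ∈ normLattice k w,
      (factor1 k θ w * z.1, factor2 k θ w * z.2) ∈ Psi k θ w := fun z hz => by
    rw [Psi_eq_scale]; exact ⟨z, hz, rfl⟩
  have hvL : vecV k θ w ∈ Psi k θ w := by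
    rw [vecV_eq]; exact img _ (right_mem_latticeSpan _ _)
  have huL : vecU k θ w ∈ Psi k θ w := by
    unfold Psi; split_ifs <;> exact left_mem_latticeSpan _ _
  have hu1 : ‖(vecU k θ w).1‖ = radius k w := by
    rw [vecU_eq, norm_mul, n1]; simp [baseU]
  have hu2 : ‖(vecU k θ w).2‖ < radius k w := by
    rw [vecU_eq, norm_mul, n2]; exact mul_lt_of_lt_one_right hρ hr.norm_snd
  have hv1 : ‖(vecV k θ w).1‖ = radius k w * ‖w.1‖ := by
    rw [vecV_eq, norm_mul, n1]; rfl
  have hv1' : ‖(vecV k θ w).1‖ < radius k w := by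
    rw [hv1]; exact mul_lt_of_lt_one_right hρ hr.norm_fst
  have hv2 : ‖(vecV k θ w).2‖ = radius k w := by
    rw [vecV_eq, norm_mul, n2]; simp [baseV]
  have hbox := fun z hz hz0 hz1 => hr.eq_unit_smul_Psi hk (θ := θ) (z := z) hz hz0 hz1
  have hleast := isLeast_returnTimes hL hvL (img X hXmem) hv1' hu1 hv2 hbox
    (by rw [← norm_pos_iff, hv1]; positivity)
    (by
      rw [hv1, norm_mul, n1]; exact mul_lt_mul_of_pos_left hX1 hρ)
    (by
      rw [norm_mul, n2]; exact lt_mul_of_one_lt_right hρ hX2)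
    (by
      intro y hy hy0 hy1
      rw [Psi_eq_scale] at hy
      obtain ⟨z, hz, rfl⟩ := hy
      simp only [hv1, norm_mul, n1, n2] at hy1 ⊢
      obtain ⟨p, hp, hle⟩ := hr.exists_candidate_le hz (by rintro rfl; simp at hy0)
        (lt_of_mul_lt_mul_left hy1 hρ.le)
      exact mul_le_mul_of_nonneg_left ((hmin p hp).trans hle) hρ.le)
    (by
      intro y hy hy2
      rw [Psi_eq_scale] at hy
      obtain ⟨z, hz, rfl⟩ := hy
      simp only [norm_mul, n1, n2, mul_right_inj' hρ.ne'] at hy2 ⊢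
      obtain ⟨c, hc1, rfl⟩ := hG.exists_smul_eq hXmem hz hX0 hy2.symm
      rw [Prod.smul_fst, norm_smul, hc1, one_mul])
  have hτ : returnTime (Psi k θ w) = _ := hleast.csInf_eq
  refine ⟨⟨hL, _, huL, _, hvL, _, hu2, hv1', hu1, hv2, hbox⟩, hτ ▸ hleast,
    ⟨coeff k w, (hiff _).2 rfl, fun q hq => (hiff q).1 hq⟩, hT1, hT2,
    existsUnique_angleChoice θ w.1, ?_⟩
  intro α θ' hα
  have hαU := hα.1
  have hα4 : α ^ 4 = 1 := hαU
  have hα0 : α ≠ 0 := by rintro rfl; norm_num at hα4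
  change _ = Psi (nextIndex k w) θ' _
  have hj12 : nextIndex k w = 1 ∨ nextIndex k w = 2 := by
    unfold nextIndex; split_ifs <;> simp
  set j := nextIndex k w
  have hprod : (α ^ 2 • TG k w).1 * (α ^ 2 • TG k w).2 = (TG k w).1 * (TG k w).2 := by
    simp only [Prod.smul_fst, Prod.smul_snd, smul_eq_mul]
    linear_combination (TG k w).1 * (TG k w).2 * hα4
  -- Both sides are det(V, X).
  have hT : w.1 * X.2 * (1 - (TG k w).1 * (TG k w).2) = coeffA k w * (1 - w.1 * w.2) := by
    rw [coeffA, ← hdet, hTG, det, baseV]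
    field_simp
  have hTne : 1 - (TG k w).1 * (TG k w).2 ≠ 0 := by
    intro h
    have h2 : ‖(TG k w).1‖ * ‖(TG k w).2‖ = 1 := by
      rw [← norm_mul, ← sub_eq_zero.1 h, norm_one]
    nlinarith [norm_nonneg (TG k w).1, norm_nonneg (TG k w).2]
  have hT' : 1 - (α ^ 2 • TG k w).1 * (α ^ 2 • TG k w).2 ≠ 0 := by rwa [hprod]
  -- Both sides become diagonal images of `normLattice j (TG k w)`; only the diagonal entries remain
  -- to be compared.
  rw [firstReturn, hτ, flow_eq_scale, Psi_eq_scale, Psi_eq_scale j, scale_normLattice_unit j hαU,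
    hlat, scale_scale, scale_scale, scale_scale]
  have hquot : ‖factor2 k θ w * X.2‖ / ‖(vecV k θ w).1‖ = ‖X.2‖ / ‖w.1‖ := by
    rw [hv1, norm_mul, n2, mul_div_mul_left _ _ hρ.ne']
  simp only [hquot]
  set t := Real.log (‖X.2‖ / ‖w.1‖) / 2 with ht
  -- The return time balances the two diagonal entries, as `eq_and_eq_of_mul_eq` requires.
  have het : Real.exp t * ‖w.1‖ = Real.exp (-t) * ‖X.2‖ := by
    rw [exp_two_mul_mul, ht, mul_div_cancel₀ _ two_ne_zero,
      Real.exp_log (div_pos (zero_lt_one.trans hX2) h0'), div_mul_cancel₀ _ h0'.ne']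
  have e0 : (Real.exp t : ℂ) * (Real.exp (-t) : ℂ) = 1 := by
    rw [← Complex.ofReal_mul, ← Real.exp_add, add_neg_cancel, Real.exp_zero, Complex.ofReal_one]
  have hρ' := radius_pos hj12 hT'
  have hw1 := Complex.norm_mul_exp_arg_mul_I w.1
  have hangle := hα.exp_eq
  obtain ⟨hc1, hc2⟩ := eq_and_eq_of_mul_eq
    (c := (Real.exp t : ℂ) * factor1 k θ w * w.1) (d := (Real.exp (-t) : ℂ) * factor2 k θ w * X.2)
    (c' := factor1 j θ' (α ^ 2 • TG k w) * α⁻¹) (d' := factor2 j θ' (α ^ 2 • TG k w) * α)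
    (x := Complex.exp ((θ + Complex.arg w.1 : ℝ) * Complex.I))
    (ρ := Real.exp t * radius k w * ‖w.1‖) (ρ' := radius j (α ^ 2 • TG k w))
    (by positivity) hρ' (Complex.norm_exp_ofReal_mul_I _)
    (by
      nth_rewrite 1 [← hw1]
      rw [factor1, unit1]
      push_cast
      rw [add_mul, Complex.exp_add]
      ring_nf)
    (by
      rw [factor1, unit1, mul_comm Complex.I, hangle]
      field_simp)
    (by
      rw [norm_mul, norm_exp_mul, n2]
      linear_combination -radius k w * het)
    (by rw [norm_mul, norm_of_mem_U4 hαU, mul_one, norm_factor2 hj12 hT'])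
    (by
      have f1 := factor1_mul_factor2 hk θ h1
      have f2 := factor1_mul_factor2 hj12 θ' hT'
      rw [hprod] at f2
      apply mul_right_cancel₀ hTne
      have hαi : α⁻¹ * α = 1 := inv_mul_cancel₀ hα0
      calc _ = (Real.exp t : ℂ) * (Real.exp (-t) : ℂ) * (factor1 k θ w * factor2 k θ w *
            (w.1 * X.2 * (1 - (TG k w).1 * (TG k w).2))) := by ring
        _ = pairDet k * coeffA k w := by rw [e0, hT, ← f1]; ring
        _ = _ := by
          rw [← hj, ← f2]
          linear_combination -(factor1 j θ' (α ^ 2 • TG k w) * factor2 j θ' (α ^ 2 • TG k w) *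
            (1 - (TG k w).1 * (TG k w).2)) * hαi)
  rw [hc1, hc2]
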